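/- Let $f:\mathbb R^n\times\mathbb R^m\to\mathbb R^n$ and $g:\mathbb R^n\times\mathbb R^m\to\mathbb R$ be continuous, let $U\subset\mathbb R^m$ be compact and convex, let $\mathrm M\in\mathbb R^{n\times n}$ be symmetric positive definite, and let $\Omega\subset\mathbb R^n$ be a nonempty bounded polyhedron, that is, $\overline\Omega$ has a regular triangulation (a finite family of non-degenerate $n$-simplices with union $\overline\Omega$, any two of which are disjoint or meet in a common face). Let $L_f,L_g>0$ and suppose that, for all $u\in U$ and $y,\tilde y\in\mathbb R^n$, $$\|f(y,u)-f(\tilde y,u)\|_2\le L_f\|y-\tilde y\|_2,\qquad |g(y,u)-g(\tilde y,u)|\le L_g\|y-\tilde y\|_2,$$ that $f$ and $g$ are bounded on $\overline\Omega\times U$, and that for some constants $C_f,C_g$ (semiconcavity) $$\|f(y+\tilde y,u)-2f(y,u)+f(y-\tilde y,u)\|_2\le C_f\|\tilde y\|_2^2,\qquad |g(y+\tilde y,u)-2g(y,u)+g(y-\tilde y,u)|\le C_g\|\tilde y\|_2^2 .$$ Suppose that for all sufficiently small $h>0$ one has $y+hf(y,u)\in\overline\Omega$ for all $y\in\overline\Omega$,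 $u\in U$, and let $\lambda>\max\{L_f,L_g\}$. Let $\mathbb U_{\mathsf{ad}}=\{u\in L^2(0,\infty;\mathbb R^m): u(t)\in U \text{ for a.a. } t>0\}$, assumed nonempty, and let $v$ be the value function $$v(y_\circ)=\inf_{u\in\mathbb U_{\mathsf{ad}}}\int_0^\infty g(y(t),u(t))\,e^{-\lambda t}\,dt,\qquad \dot y(t)=f(y(t),u(t))\ \text{for a.a. } t>0,\quad y(0)=y_\circ .$$ Then for every $R\in\mathbb R$ there are constants $c_0,c_1,c_2\ge0$ (depending on $R$ and on the data $f,g,U,\lambda,\mathrm M,\Omega$ above, but not on anything introduced below) such that the following holds. Let $\Psi\in\mathbb R^{n\times\ell}$ be any matrix with $\Psi^\top\mathrm M\Psi=\mathrm{Id}$ (for example, the matrix of a POD basis of rank $\ell$), put $\mathcal P^\ell=\Psi\Psi^\top\mathrm M$, and let $\Omega^\ell\subset\{z\in\mathbb R^\ell:\|z\|_2\le R\}$ be a polyhedron with $$\Psi^\top\mathrm My\in\mathrm{int}\,\Omega^\ell\quad\text{for all }y\in\overline\Omega .$$ Let a regular triangulation of $\Omega^\ell$ into $\ell$-simplices with maximal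 diameter $K$ be given, let $0<h<1/\lambda$, and suppose that $$\Psi^\top\mathrm M\big(y+hf(\mathcal P^\ell y,u)\big)\in\overline{\Omega^\ell}\quad\text{for all }y\in\overline\Omega,\ u\in U .$$ Let $v^\ell_{hK}:\overline{\Omega^\ell}\to\mathbb R$ be continuous, affine on each simplex of the triangulation, and a solution of the POD scheme $$v^\ell_{hK}(z)=\min_{u\in U}\big\{(1-\lambda h)\,v^\ell_{hK}\big(z+h\Psi^\top\mathrm Mf(\Psi z,u)\big)+h\,g(\Psi z,u)\big\}\quad\text{for every vertex } z,$$ where the points $z+h\Psi^\top\mathrm Mf(\Psi z,u)$ ($z$ a vertex, $u\in U$) lie in $\overline{\Omega^\ell}$, so that the scheme is defined. Put $\widetilde v^\ell_{hK}(y)=v^\ell_{hK}(\Psi^\top\mathrm My)$ for $y\in\overline\Omega$. Then $$\sup_{y\in\overline\Omega}\big|v(y)-\widetilde v^\ell_{hK}(y)\big|\le c_0\,h+c_1\,\|\Psi\|_2\,\frac Kh+c_2\,\frac1h\,\sup_{y\in\overline\Omega}\|y-\mathcal P^\ell y\|_2 .$$ -/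

import Mathlib

open MeasureTheory Filter Topology Set

noncomputable section

namespace PODHJB

/-- `ℝⁿ` with the Euclidean norm. -/
abbrev E (n : ℕ) : Type := EuclideanSpace ℝ (Fin n)

/-- The matrix-vector product `A y`, between Euclidean spaces. -/
def mulE {p q : ℕ} (A : Matrix (Fin p) (Fin q) ℝ) (y : E q) : E p :=
  WithLp.toLp 2 (A.mulVec y.ofLp)

/-- The spectral norm `‖A‖₂`, i.e. the operator norm for the Euclidean norms. -/
def specNorm {p q : ℕ} (A : Matrix (Fin p) (Fin q) ℝ) : ℝ :=
  ‖LinearMap.toContinuousLinearMap (Matrix.toEuclideanLin A)‖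

/-! ### The optimal control problem -/

/-- Admissible controls: `u ∈ L²(0,∞;ℝᵐ)` with `u(t) ∈ U` for almost all `t > 0`. -/
def admissibleControls {m : ℕ} (U : Set (E m)) : Set (ℝ → E m) :=
  {u | MemLp u 2 (volume.restrict (Ioi (0 : ℝ))) ∧
    ∀ᵐ t ∂(volume.restrict (Ioi (0 : ℝ))), u t ∈ U}

/-- `y` solves `ẏ(t) = f(y(t),u(t))` for almost all `t > 0`, `y(0) = y₀` (Carathéodory solution,
written in integrated form). -/
def IsTrajectory {n m : ℕ} (f : E n → E m → E n) (u : ℝ → E m) (y₀ : E n) (y : ℝ → E n) : Prop :=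
  ContinuousOn y (Ici 0) ∧
  ∀ t, 0 ≤ t → IntervalIntegrable (fun s => f (y s) (u s)) volume 0 t ∧
    y t = y₀ + ∫ s in (0 : ℝ)..t, f (y s) (u s)

/-- The discounted infinite horizon cost `J(y,u) = ∫₀^∞ g(y(t),u(t)) e^{-λt} dt`. -/
def cost {n m : ℕ} (g : E n → E m → ℝ) (lam : ℝ) (y : ℝ → E n) (u : ℝ → E m) : ℝ :=
  ∫ t in Ioi (0 : ℝ), g (y t) (u t) * Real.exp (-(lam * t))

/-- The value function `v(y₀) = inf { J(y(u;y₀),u) | u admissible }`. -/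
def valueFunction {n m : ℕ} (f : E n → E m → E n) (g : E n → E m → ℝ) (lam : ℝ) (U : Set (E m))
    (y₀ : E n) : ℝ :=
  sInf {c | ∃ u ∈ admissibleControls U, ∃ y, IsTrajectory f u y₀ y ∧ c = cost g lam y u}

/-- Continuity of `f` and `g`, Lipschitz continuity in the state with constants `Lf`, `Lg`,
uniformly over the controls in `U`, and boundedness on `closure Ω × U`. -/
structure StandingAssumption {n m : ℕ} (f : E n → E m → E n) (g : E n → E m → ℝ) (U : Set (E m))
    (Ω : Set (E n)) (Lf Lg : ℝ) : Prop where
  Lf_pos : 0 < Lf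
  f_cont : Continuous (fun p : E n × E m => f p.1 p.2)
  f_lip : ∀ y y' : E n, ∀ u ∈ U, ‖f y u - f y' u‖ ≤ Lf * ‖y - y'‖
  f_bdd : ∃ Mf : ℝ, ∀ y ∈ closure Ω, ∀ u ∈ U, ∀ i, |f y u i| ≤ Mf
  Lg_pos : 0 < Lg
  g_cont : Continuous (fun p : E n × E m => g p.1 p.2)
  g_lip : ∀ y y' : E n, ∀ u ∈ U, |g y u - g y' u| ≤ Lg * ‖y - y'‖
  g_bdd : ∃ Mg : ℝ, 0 < Mg ∧ ∀ y ∈ closure Ω, ∀ u ∈ U, |g y u| ≤ Mg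

/-- The semiconcavity conditions on `f` and `g`. -/
def Semiconcave {n m : ℕ} (f : E n → E m → E n) (g : E n → E m → ℝ) (U : Set (E m)) : Prop :=
  (∃ Cf : ℝ, ∀ y z : E n, ∀ u ∈ U,
    ‖f (y + z) u - (2 : ℝ) • f y u + f (y - z) u‖ ≤ Cf * ‖z‖ ^ 2) ∧
  (∃ Cg : ℝ, ∀ y z : E n, ∀ u ∈ U,
    |g (y + z) u - 2 * g y u + g (y - z) u| ≤ Cg * ‖z‖ ^ 2)

/-! ### Polyhedra and triangulations -/

/-- `𝒯` is a regular triangulation of `Ω ⊆ ℝᵈ`: finitely many `d`-simplices, meeting along common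
faces (this is part of `Geometry.SimplicialComplex`), whose union is `closure Ω`. The complex `𝒯`
consists of the `d`-simplices and of their faces, each given by its finite set of vertices. -/
structure IsTriangulation {d : ℕ} (𝒯 : Geometry.SimplicialComplex ℝ (E d)) (Ω : Set (E d)) :
    Prop where
  finite : 𝒯.faces.Finite
  pure : ∀ s ∈ 𝒯.faces, ∃ t ∈ 𝒯.faces, s ⊆ t ∧ t.card = d + 1
  space_eq : 𝒯.space = closure Ω

/-- A (nonempty) bounded polyhedron: a set whose closure can be triangulated. -/
def IsBoundedPolyhedron {d : ℕ} (Ω : Set (E d)) : Prop :=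
  Ω.Nonempty ∧ ∃ 𝒯 : Geometry.SimplicialComplex ℝ (E d), IsTriangulation 𝒯 Ω

/-- The mesh size: the maximal diameter of the `d`-simplices of the triangulation. -/
def meshSize {d : ℕ} (𝒯 : Geometry.SimplicialComplex ℝ (E d)) : ℝ :=
  sSup {r | ∃ s ∈ 𝒯.faces, s.card = d + 1 ∧ r = Metric.diam (convexHull ℝ (s : Set (E d)))}

/-- Membership (of the restriction to `closure Ω`) in the space of continuous functions on
`closure Ω` that are affine on every `d`-simplex of the triangulation `𝒯` of `Ω`. -/
def IsPiecewiseAffine {d : ℕ} (𝒯 : Geometry.SimplicialComplex ℝ (E d)) (Ω : Set (E d))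
    (w : E d → ℝ) : Prop :=
  ContinuousOn w (closure Ω) ∧
  ∀ s ∈ 𝒯.faces, s.card = d + 1 →
    ∃ a : E d →ᵃ[ℝ] ℝ, EqOn w a (convexHull ℝ (s : Set (E d)))

/-! ### The reduced-order scheme -/

/-- The reduced dynamics `f^ℓ(z,u) = Ψᵀ M f(Ψ z, u)`. -/
def redDyn {n m l : ℕ} (Mm : Matrix (Fin n) (Fin n) ℝ) (Ψ : Matrix (Fin n) (Fin l) ℝ)
    (f : E n → E m → E n) (z : E l) (u : E m) : E l :=
  mulE (Ψ.transpose * Mm) (f (mulE Ψ z) u)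

/-- The reduced running cost `g^ℓ(z,u) = g(Ψ z, u)`. -/
def redCost {n m l : ℕ} (Ψ : Matrix (Fin n) (Fin l) ℝ) (g : E n → E m → ℝ) (z : E l) (u : E m) :
    ℝ :=
  g (mulE Ψ z) u

/-- The projection `P^ℓ y = Ψ Ψᵀ M y`. -/
def proj {n l : ℕ} (Mm : Matrix (Fin n) (Fin n) ℝ) (Ψ : Matrix (Fin n) (Fin l) ℝ) (y : E n) : E n :=
  mulE (Ψ * Ψ.transpose * Mm) y

/-- `sup_{y ∈ closure Ω} ‖y - P^ℓ y‖₂`. -/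
def projError {n l : ℕ} (Mm : Matrix (Fin n) (Fin n) ℝ) (Ψ : Matrix (Fin n) (Fin l) ℝ)
    (Ω : Set (E n)) : ℝ :=
  sSup ((fun y => ‖y - proj Mm Ψ y‖) '' closure Ω)

/-- `w` solves the fully discrete scheme on the triangulation `𝒯` of `Ωl`: it is piecewise affine
and, at every vertex `z`,
`w(z) = min_{u ∈ U} { (1 - λh) w(z + h f^ℓ(z,u)) + h g^ℓ(z,u) }`,
where the points `z + h f^ℓ(z,u)` belong to the domain `closure Ωl` of `w`. -/
structure IsSchemeSolution {n m l : ℕ} (f : E n → E m → E n) (g : E n → E m → ℝ) (lam : ℝ)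
    (U : Set (E m)) (Mm : Matrix (Fin n) (Fin n) ℝ) (Ψ : Matrix (Fin n) (Fin l) ℝ)
    (Ωl : Set (E l)) (𝒯 : Geometry.SimplicialComplex ℝ (E l)) (h : ℝ) (w : E l → ℝ) : Prop where
  affine : IsPiecewiseAffine 𝒯 Ωl w
  mem : ∀ z ∈ 𝒯.vertices, ∀ u ∈ U, z + h • redDyn Mm Ψ f z u ∈ closure Ωl
  eq_min : ∀ z ∈ 𝒯.vertices,
    IsLeast ((fun u => (1 - lam * h) * w (z + h • redDyn Mm Ψ f z u) + h * redCost Ψ g z u) '' U)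
      (w z)

/-- The approximate value function on the full space, `ṽ(y) = w(Ψᵀ M y)`. -/
def lift {n l : ℕ} (Mm : Matrix (Fin n) (Fin n) ℝ) (Ψ : Matrix (Fin n) (Fin l) ℝ)
    (w : E l → ℝ) (y : E n) : ℝ :=
  w (mulE (Ψ.transpose * Mm) y)

end PODHJB

end

/-! Both the value function and the solution of the scheme are compared with one intermediate
object: the discounted cost `discCost` of `N` explicit Euler steps in the full space, driven by a
sequence of controls in `U`. All bounds have constants independent of `N`, up to remainders that
vanish as `N → ∞`.

Scheme against discrete costs (`IsSchemeSolution.compare_discCost`). A piecewise affine function at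
a point lies between its values at two vertices of a simplex containing it, and at vertices the
scheme is a dynamic programming equation for the projected dynamics. Induction on `N` then only
moves the initial state of `discCost`, whose Lipschitz constant `Lg / (lam - L)` depends neither on
`h` nor on `N` (`abs_discCost_sub_le`); no regularity of the discrete solution enters. Each step
costs one mesh term and `h` times one projection term, and the geometric series divides their sum by
`lam * h`. The projection error on `closure Ω` controls the operator norm of `Id - P^ℓ`, because
`closure Ω` contains a ball.

Discrete against continuous costs (`exists_cost_error_bound`). A control sequence is the step
control it defines. Conversely, given a control `u` with trajectory `y`, the average of `(f, g)(y (k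
h), u)` over step `k` lies in the closed convex hull of `(f, g)(y (k h), U)`. The Bárány–Grinberg
theorem, obtained from the Shapley–Folkman exchange, selects actual values `v k ∈ U` so that all
prefix sums of the errors stay bounded by the dimension times the size of the vectors. Multiplied by
`h`, this is an `O(h)` defect. Gronwall turns it into an `O(h)` Euler error, and summation by parts
into an `O(h)` cost error. Everything is allowed to grow like `exp (μ t)` with `Lf < μ < lam`, so
the discount makes the constants uniform over infinite time. -/

noncomputable section

namespace PODHJB

/-! ### Shapley–Folkman exchange and prefix sums in finite dimension -/

section VectorBalancing

variable {V : Type*} [NormedAddCommGroup V] [NormedSpace ℝ V] [FiniteDimensional ℝ V]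

/-- One step of the Shapley–Folkman lemma: if there are more summands than dimensions, a point of
`∑ conv (S i)` can be written with one of the summands in `S i`. -/
lemma exists_sum_eq_exists_mem {ι : Type*} [Fintype ι] (hι : Module.finrank ℝ V < Fintype.card ι)
    (S : ι → Set V) (p : ι → V) (hp : ∀ i, p i ∈ convexHull ℝ (S i)) :
    ∃ q : ι → V, (∀ i, q i ∈ convexHull ℝ (S i)) ∧ ∑ i, q i = ∑ i, p i ∧ ∃ i, q i ∈ S i := by
  -- Finite subsets have compact hulls, so the selections with the prescribed sum form a compact set
  -- and an extreme point exists.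
  have hfin : ∀ i, ∃ T : Finset V, (T : Set V) ⊆ S i ∧ p i ∈ convexHull ℝ (T : Set V) := by
    intro i
    have h := hp i
    rw [convexHull_eq_union_convexHull_finite_subsets] at h
    simpa using h
  choose T hTS hpT using hfin
  let C : Set (ι → V) := {q | (∀ i, q i ∈ convexHull ℝ (T i : Set V)) ∧ ∑ i, q i = ∑ i, p i}
  have hCcomp : IsCompact C := by
    have h1 : IsCompact (Set.pi univ fun i => convexHull ℝ (T i : Set V)) :=
      isCompact_univ_pi fun i => (T i).finite_toSet.isCompact_convexHull ℝ
    have h2 : IsClosed {q : ι → V | ∑ i, q i = ∑ i, p i} :=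
      isClosed_eq (by fun_prop) continuous_const
    convert h1.inter_right h2 using 1
    ext q; simp [C]
  obtain ⟨q, hqC, hqext⟩ := hCcomp.extremePoints_nonempty ⟨p, hpT, rfl⟩
  refine ⟨q, fun i => convexHull_mono (hTS i) (hqC.1 i), hqC.2, ?_⟩
  by_contra! hno
  -- A component outside `T i` is not extreme in its hull and can move both ways. With `q i = s a +
  -- t b`, a shift by at most `min s t` times `b - a` keeps both weights nonnegative. There are more
  -- such directions than dimensions, so a linear dependence moves `q` both ways inside `C`,
  -- contradicting extremality.
  have hdir : ∀ i, ∃ d : V, d ≠ 0 ∧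
      ∀ c : ℝ, |c| ≤ 1 → q i + c • d ∈ convexHull ℝ (T i : Set V) := by
    intro i
    have hnot : q i ∉ (convexHull ℝ (T i : Set V)).extremePoints ℝ := fun h =>
      hno i (hTS i (extremePoints_convexHull_subset h))
    simp only [mem_extremePoints_iff_left, not_and, not_forall] at hnot
    obtain ⟨a, ha, b, hb, hab, hne⟩ := hnot (hqC.1 i)
    obtain ⟨s, t, hs, ht, hst, hq⟩ := hab
    refine ⟨(min s t) • (b - a), ?_, ?_⟩
    · refine smul_ne_zero (lt_min hs ht).ne' (sub_ne_zero.2 fun h => hne ?_)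
      rw [← hq, h, ← add_smul, hst, one_smul]
    · intro c hc
      have hm := lt_min hs ht
      have hc' := abs_le.1 hc
      have hcm : |c * min s t| ≤ min s t := by
        rw [abs_mul, abs_of_pos hm]; nlinarith
      have hcm' := abs_le.1 hcm
      have e : q i + c • (min s t) • (b - a)
          = (s - c * min s t) • a + (t + c * min s t) • b := by
        rw [← hq]; module
      rw [e]
      refine convex_convexHull ℝ _ ha hb ?_ ?_ (by linarith)
      · linarith [min_le_left s t]
      · linarith [min_le_right s t]
  choose d hd0 hd using hdir
  have hdep : ¬ LinearIndependent ℝ d := fun h => by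
    have := h.fintype_card_le_finrank
    omega
  obtain ⟨c, hc0, i₀, hi₀⟩ := Fintype.not_linearIndependent_iff.1 hdep
  let m : ℝ := ‖c‖
  have hm : 0 < m := norm_pos_iff.2 fun h => hi₀ (by simp [h])
  have hle : ∀ i, |c i / m| ≤ 1 := fun i => by
    rw [abs_div, abs_of_pos hm, div_le_one hm]
    exact norm_le_pi_norm c i
  have hsum : ∑ i, (c i / m) • d i = 0 := by
    have : ∀ i, (c i / m) • d i = m⁻¹ • (c i • d i) := fun i => by
      rw [smul_smul, div_eq_inv_mul]
    simp_rw [this]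
    rw [← Finset.smul_sum, hc0, smul_zero]
  have hmem1 : (fun i => q i + (c i / m) • d i) ∈ C :=
    ⟨fun i => hd i _ (hle i), by rw [Finset.sum_add_distrib, hsum, add_zero, hqC.2]⟩
  have hmem2 : (fun i => q i + (-(c i / m)) • d i) ∈ C :=
    ⟨fun i => hd i _ (by rw [abs_neg]; exact hle i), by
      simp_rw [neg_smul]
      rw [Finset.sum_add_distrib, Finset.sum_neg_distrib, hsum, neg_zero, add_zero, hqC.2]⟩
  have hseg : q ∈ openSegment ℝ (fun i => q i + (c i / m) • d i)
      (fun i => q i + (-(c i / m)) • d i) := by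
    refine ⟨1 / 2, 1 / 2, by norm_num, by norm_num, by norm_num, ?_⟩
    ext i
    simp only [Pi.add_apply, Pi.smul_apply]
    module
  have h := congrFun (hqext hmem1 hmem2 hseg) i₀
  simp only [add_eq_left, smul_eq_zero, div_eq_zero_iff] at h
  rcases h with (h | h) | h
  · exact hi₀ h
  · exact hm.ne' h
  · exact hd0 _ h

lemma exists_finset_sum_eq_exists_mem (A : Finset ℕ) (hA : Module.finrank ℝ V < A.card)
    (S : ℕ → Set V) (p : ℕ → V) (hp : ∀ i, p i ∈ convexHull ℝ (S i)) :
    ∃ q : ℕ → V, (∀ i, q i ∈ convexHull ℝ (S i)) ∧ (∀ i ∉ A, q i = p i) ∧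
      ∑ i ∈ A, q i = ∑ i ∈ A, p i ∧ ∃ i ∈ A, q i ∈ S i := by
  classical
  obtain ⟨q, hq, hsum, i, hi⟩ := exists_sum_eq_exists_mem (V := V) (ι := A) (by simpa using hA)
    (fun i => S i) (fun i => p i) (fun i => hp i)
  refine ⟨fun j => if hj : j ∈ A then q ⟨j, hj⟩ else p j, ?_, ?_, ?_, i, i.2, ?_⟩
  · intro j
    by_cases hj : j ∈ A
    · simpa [hj] using hq ⟨j, hj⟩
    · simpa [hj] using hp j
  · intro j hj; simp [hj]
  · rw [← Finset.sum_coe_sort A, ← Finset.sum_coe_sort A p, ← hsum]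
    exact Finset.sum_congr rfl fun j _ => by simp
  · simpa using hi

/-- At most `finrank` indices `A` are kept floating in their hulls; the others are frozen at points
of `S i`. Each new index starts as floating, and when there are too many, the exchange step freezes
one without changing the total. The last clause concerns every `v` that agrees with `q` off `A`, not
just `q`, because floating summands may still change later. Such a `v` differs from a family with
the exact prefix sum in at most `finrank` summands, each by at most `2 * s k`. -/
lemma exists_floating_prefix_bound (S : ℕ → Set V) (s : ℕ → ℝ) (hmono : Monotone s)
    (hs : ∀ k, ∀ v ∈ S k, ‖v‖ ≤ s k) (x : ℕ → V) (hx : ∀ k, x k ∈ convexHull ℝ (S k)) (N : ℕ) :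
    ∃ (A : Finset ℕ) (q : ℕ → V), A.card ≤ Module.finrank ℝ V ∧ A ⊆ Finset.range N ∧
      (∀ i, q i ∈ convexHull ℝ (S i)) ∧ (∀ i < N, i ∉ A → q i ∈ S i) ∧
      (∀ i, N ≤ i → q i = x i) ∧
      ∑ i ∈ Finset.range N, q i = ∑ i ∈ Finset.range N, x i ∧
      ∀ v : ℕ → V, (∀ i, v i ∈ convexHull ℝ (S i)) → (∀ i < N, i ∉ A → v i = q i) →
        ∀ k ≤ N, ‖∑ i ∈ Finset.range k, (v i - x i)‖ ≤ 2 * Module.finrank ℝ V * s k := by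
  classical
  have hsc : ∀ k, ∀ v ∈ convexHull ℝ (S k), ‖v‖ ≤ s k := fun k v hv => by
    have := convexHull_min (t := Metric.closedBall (0 : V) (s k))
      (fun v hv => by simpa using hs k v hv) (convex_closedBall _ _) hv
    simpa using this
  induction N with
  | zero =>
    refine ⟨∅, x, by simp, by simp, hx, by simp, by simp, by simp, ?_⟩
    intro v _ _ k hk
    obtain rfl : k = 0 := by omega
    have : 0 ≤ s 0 := (norm_nonneg _).trans (hsc 0 _ (hx 0))
    simp only [Finset.range_zero, Finset.sum_empty, norm_zero]
    positivity
  | succ N ih =>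
    obtain ⟨A, q, hcard, hAN, hqc, hqS, hqx, hsum, hpre⟩ := ih
    have hNA : N ∉ A := fun h => by simpa using hAN h
    -- the new family of floating indices
    have hnew : ∃ (A' : Finset ℕ) (q' : ℕ → V), A'.card ≤ Module.finrank ℝ V ∧
        A' ⊆ insert N A ∧ (∀ i, q' i ∈ convexHull ℝ (S i)) ∧ (∀ i ∉ insert N A, q' i = q i) ∧
        (∀ i ∈ insert N A, i ∉ A' → q' i ∈ S i) ∧
        ∑ i ∈ insert N A, q' i = ∑ i ∈ insert N A, q i := by
      by_cases hlt : (insert N A).card ≤ Module.finrank ℝ V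
      · exact ⟨insert N A, q, hlt, subset_rfl, hqc, fun _ _ => rfl, fun i h h' => absurd h h', rfl⟩
      · obtain ⟨q', h1, h2, h3, i, hi, hiS⟩ := exists_finset_sum_eq_exists_mem (insert N A)
          (not_le.1 hlt) S q hqc
        refine ⟨(insert N A).erase i, q', ?_, Finset.erase_subset _ _, h1, h2, ?_, h3⟩
        · rw [Finset.card_erase_of_mem hi, Finset.card_insert_of_notMem hNA]; omega
        · intro j hj hj'
          have : j = i := by
            by_contra hne; exact hj' (Finset.mem_erase.2 ⟨hne, hj⟩)
          rwa [this]
    obtain ⟨A', q', hcard', hA', hqc', hq'off, hq'S, hsum'⟩ := hnew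
    have hins : insert N A ⊆ Finset.range (N + 1) :=
      Finset.insert_subset (by simp) (hAN.trans (Finset.range_subset_range.2 N.le_succ))
    have hsumq' : ∑ i ∈ Finset.range (N + 1), q' i = ∑ i ∈ Finset.range (N + 1), x i := by
      rw [← Finset.sum_sdiff hins, hsum',
        Finset.sum_congr rfl fun i hi => hq'off i (Finset.mem_sdiff.1 hi).2,
        Finset.sum_sdiff hins, Finset.sum_range_succ, Finset.sum_range_succ, hsum, hqx N le_rfl]
    refine ⟨A', q', hcard', hA'.trans hins, hqc', ?_, ?_, hsumq', ?_⟩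
    · intro i hi hiA'
      by_cases hi' : i ∈ insert N A
      · exact hq'S i hi' hiA'
      · rw [hq'off i hi']
        rw [Finset.mem_insert, not_or] at hi'
        exact hqS i (by omega) hi'.2
    · intro i hi
      rw [hq'off i (fun h => by have := hins h; simp at this; omega), hqx i (by omega)]
    · intro v hv hvq k hk
      rcases Nat.lt_or_ge N k with hk' | hk'
      · obtain rfl : k = N + 1 := by omega
        have e : ∑ i ∈ Finset.range (N + 1), (v i - x i) = ∑ i ∈ A', (v i - q' i) := by
          rw [Finset.sum_sub_distrib, ← hsumq', ← Finset.sum_sub_distrib]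
          symm
          refine Finset.sum_subset (hA'.trans hins) fun i hi hi' => ?_
          rw [hvq i (by simpa using hi) hi', sub_self]
        rw [e]
        have hsnn : 0 ≤ s (N + 1) := (norm_nonneg _).trans (hsc _ _ (hx _))
        calc ‖∑ i ∈ A', (v i - q' i)‖ ≤ ∑ i ∈ A', 2 * s (N + 1) := by
              refine norm_sum_le_of_le _ fun i hi => (norm_sub_le _ _).trans ?_
              have hi' : i ≤ N + 1 := by have := hins (hA' hi); simp at this; omega
              have := hsc i _ (hv i)
              have := hsc i _ (hqc' i)
              have := hmono hi'
              linarith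
          _ = A'.card * (2 * s (N + 1)) := by simp
          _ ≤ Module.finrank ℝ V * (2 * s (N + 1)) := by gcongr
          _ = _ := by ring
      · refine hpre v hv (fun i hi hiA => ?_) k hk'
        have hi' : i ∉ insert N A := by
          rw [Finset.mem_insert, not_or]; exact ⟨by omega, hiA⟩
        rw [hvq i (by omega) (fun h => hi' (hA' h)), hq'off i hi']

/-- The Bárány–Grinberg theorem on prefix sums: points of convex hulls can be replaced by points of
the sets themselves with all prefix sums of the errors bounded in terms of the dimension. -/
theorem exists_mem_prefix_sum_le (S : ℕ → Set V) (s : ℕ → ℝ) (hmono : Monotone s)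
    (hs : ∀ k, ∀ v ∈ S k, ‖v‖ ≤ s k) (x : ℕ → V) (hx : ∀ k, x k ∈ convexHull ℝ (S k)) (N : ℕ) :
    ∃ v : ℕ → V, (∀ k, v k ∈ S k) ∧
      ∀ k ≤ N, ‖∑ i ∈ Finset.range k, (v i - x i)‖ ≤ 2 * Module.finrank ℝ V * s k := by
  classical
  obtain ⟨A, q, -, -, -, hqS, -, -, hpre⟩ := exists_floating_prefix_bound S s hmono hs x hx N
  have hne : ∀ k, (S k).Nonempty := fun k => convexHull_nonempty_iff.1 ⟨_, hx k⟩
  choose a ha using hne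
  let v : ℕ → V := fun i => if i < N ∧ i ∉ A then q i else a i
  have hv : ∀ k, v k ∈ S k := fun k => by
    by_cases h : k < N ∧ k ∉ A
    · simpa only [v, if_pos h] using hqS k h.1 h.2
    · simpa only [v, if_neg h] using ha k
  exact ⟨v, hv, hpre v (fun i => subset_convexHull ℝ _ (hv i)) fun i hi hiA => if_pos ⟨hi, hiA⟩⟩

/-- Averages of integrals are only known to lie in the closed hull. Moving each point into the hull
by less than `1 / (N + 1)` costs at most `1` in any prefix sum up to `N`. -/
theorem exists_mem_prefix_sum_le_of_mem_closure (S : ℕ → Set V) (s : ℕ → ℝ) (hmono : Monotone s)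
    (hs : ∀ k, ∀ v ∈ S k, ‖v‖ ≤ s k) (x : ℕ → V) (hx : ∀ k, x k ∈ closure (convexHull ℝ (S k)))
    (N : ℕ) :
    ∃ v : ℕ → V, (∀ k, v k ∈ S k) ∧
      ∀ k ≤ N, ‖∑ i ∈ Finset.range k, (v i - x i)‖ ≤ 2 * Module.finrank ℝ V * s k + 1 := by
  have hε : (0 : ℝ) < 1 / (N + 1) := by positivity
  choose x' hx' hd using fun k => Metric.mem_closure_iff.1 (hx k) _ hε
  obtain ⟨v, hv, hpre⟩ := exists_mem_prefix_sum_le S s hmono hs x' hx' N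
  refine ⟨v, hv, fun k hk => ?_⟩
  have e : ∑ i ∈ Finset.range k, (v i - x i)
      = ∑ i ∈ Finset.range k, (v i - x' i) + ∑ i ∈ Finset.range k, (x' i - x i) := by
    rw [← Finset.sum_add_distrib]; simp
  rw [e]
  refine (norm_add_le _ _).trans (add_le_add (hpre k hk) ?_)
  calc ‖∑ i ∈ Finset.range k, (x' i - x i)‖ ≤ ∑ i ∈ Finset.range k, 1 / ((N : ℝ) + 1) := by
        refine norm_sum_le_of_le _ fun i _ => ?_
        rw [← dist_eq_norm, dist_comm]; exact (hd i).le
    _ = k / ((N : ℝ) + 1) := by simp [div_eq_mul_inv]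
    _ ≤ 1 := by
        rw [div_le_one (by positivity)]
        have : (k : ℝ) ≤ N := by exact_mod_cast hk
        linarith

end VectorBalancing

/-! ### Matrices between Euclidean spaces and `M`-orthonormality -/

section LinearAlgebra

lemma mulE_eq {p q : ℕ} (A : Matrix (Fin p) (Fin q) ℝ) (y : E q) :
    mulE A y = LinearMap.toContinuousLinearMap (Matrix.toEuclideanLin A) y := rfl

lemma norm_mulE_le {p q : ℕ} (A : Matrix (Fin p) (Fin q) ℝ) (y : E q) :
    ‖mulE A y‖ ≤ specNorm A * ‖y‖ := by
  rw [mulE_eq]; exact ContinuousLinearMap.le_opNorm _ _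

lemma specNorm_nonneg {p q : ℕ} (A : Matrix (Fin p) (Fin q) ℝ) : 0 ≤ specNorm A := norm_nonneg _

lemma mulE_add {p q : ℕ} (A : Matrix (Fin p) (Fin q) ℝ) (x y : E q) :
    mulE A (x + y) = mulE A x + mulE A y := by
  simp only [mulE_eq, map_add]

lemma mulE_sub {p q : ℕ} (A : Matrix (Fin p) (Fin q) ℝ) (x y : E q) :
    mulE A (x - y) = mulE A x - mulE A y := by
  simp only [mulE_eq, map_sub]

lemma mulE_smul {p q : ℕ} (A : Matrix (Fin p) (Fin q) ℝ) (c : ℝ) (y : E q) :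
    mulE A (c • y) = c • mulE A y := by
  simp only [mulE_eq, map_smul]

lemma mulE_mul {p q r : ℕ} (A : Matrix (Fin p) (Fin q) ℝ) (B : Matrix (Fin q) (Fin r) ℝ)
    (y : E r) : mulE (A * B) y = mulE A (mulE B y) := by
  simp [mulE, Matrix.mulVec_mulVec]

lemma proj_eq {n l : ℕ} (Mm : Matrix (Fin n) (Fin n) ℝ) (Ψ : Matrix (Fin n) (Fin l) ℝ) (y : E n) :
    proj Mm Ψ y = mulE Ψ (mulE (Ψ.transpose * Mm) y) := by
  rw [proj, Matrix.mul_assoc, mulE_mul]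

lemma mulE_redDyn {n m l : ℕ} (Mm : Matrix (Fin n) (Fin n) ℝ) (Ψ : Matrix (Fin n) (Fin l) ℝ)
    (f : E n → E m → E n) (z : E l) (u : E m) :
    mulE Ψ (redDyn Mm Ψ f z u) = proj Mm Ψ (f (mulE Ψ z) u) := by
  rw [proj_eq, redDyn]

/-- `x ↦ xᵀ M x` controls the Euclidean norm. -/
lemma exists_norm_sq_le_of_posDef {n : ℕ} (Mm : Matrix (Fin n) (Fin n) ℝ) (hMm : Mm.PosDef) :
    ∃ c : ℝ, 0 ≤ c ∧ ∀ x : E n, ‖x‖ ≤ c * Real.sqrt (x.ofLp ⬝ᵥ Mm.mulVec x.ofLp) := by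
  have hpos : ∀ x : E n, x ≠ 0 → 0 < x.ofLp ⬝ᵥ Mm.mulVec x.ofLp := fun x hx => by
    have := hMm.dotProduct_mulVec_pos (x := x.ofLp) (by simpa using hx)
    simpa using this
  have hcont : Continuous fun x : E n => Real.sqrt (x.ofLp ⬝ᵥ Mm.mulVec x.ofLp) := by
    simp only [dotProduct, Matrix.mulVec]
    fun_prop
  have hinv : ContinuousOn (fun x : E n => (Real.sqrt (x.ofLp ⬝ᵥ Mm.mulVec x.ofLp))⁻¹)
      (Metric.sphere 0 1) := by
    refine hcont.continuousOn.inv₀ fun x hx => ?_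
    have hx0 : x ≠ 0 := by
      rintro rfl; simp at hx
    exact (Real.sqrt_pos.2 (hpos x hx0)).ne'
  obtain ⟨c, hc⟩ := (isCompact_sphere (0 : E n) 1).exists_bound_of_continuousOn hinv
  refine ⟨max c 0, le_max_right _ _, fun x => ?_⟩
  by_cases hx : x = 0
  · subst hx; simp
  have hnx : 0 < ‖x‖ := norm_pos_iff.2 hx
  have hmem : ‖x‖⁻¹ • x ∈ Metric.sphere (0 : E n) 1 := by
    simp [norm_smul, hnx.ne']
  have h1 := hc _ hmem
  have e : ((‖x‖⁻¹ • x).ofLp ⬝ᵥ Mm.mulVec (‖x‖⁻¹ • x).ofLp)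
      = (‖x‖⁻¹) ^ 2 * (x.ofLp ⬝ᵥ Mm.mulVec x.ofLp) := by
    simp only [WithLp.ofLp_smul, Matrix.mulVec_smul, smul_dotProduct, dotProduct_smul, smul_eq_mul]
    ring
  rw [e, Real.sqrt_mul (by positivity), Real.sqrt_sq (by positivity), Real.norm_eq_abs] at h1
  have hs := Real.sqrt_pos.2 (hpos x hx)
  rw [abs_of_pos (by positivity), mul_inv, inv_inv] at h1
  have h2 : ‖x‖ * (Real.sqrt (x.ofLp ⬝ᵥ Mm.mulVec x.ofLp))⁻¹ ≤ max c 0 := h1.trans (le_max_left _ _)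
  rwa [← div_eq_mul_inv, div_le_iff₀ hs] at h2

/-- Matrices with `M`-orthonormal columns are bounded, uniformly in the number of columns. -/
lemma exists_norm_mulE_le_of_orthonormal {n : ℕ} (Mm : Matrix (Fin n) (Fin n) ℝ)
    (hMm : Mm.PosDef) :
    ∃ c : ℝ, 0 ≤ c ∧ ∀ (l : ℕ) (Ψ : Matrix (Fin n) (Fin l) ℝ), Ψ.transpose * Mm * Ψ = 1 →
      ∀ z : E l, ‖mulE Ψ z‖ ≤ c * ‖z‖ := by
  obtain ⟨c, hc0, hc⟩ := exists_norm_sq_le_of_posDef Mm hMm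
  refine ⟨c, hc0, fun l Ψ hΨ z => (hc _).trans ?_⟩
  -- Orthonormality makes `Ψ` an isometry into the `M`-norm, so only the constant comparing the
  -- Euclidean norm with the `M`-norm remains.
  have e : (mulE Ψ z).ofLp ⬝ᵥ Mm.mulVec (mulE Ψ z).ofLp = ‖z‖ ^ 2 := by
    have : z.ofLp ⬝ᵥ (Ψ.transpose * Mm * Ψ).mulVec z.ofLp = ‖z‖ ^ 2 := by
      rw [hΨ, Matrix.one_mulVec, EuclideanSpace.norm_sq_eq]
      simp [dotProduct, sq]
    rw [← this, ← Matrix.mulVec_mulVec, ← Matrix.mulVec_mulVec, Matrix.dotProduct_mulVec z.ofLp,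
      Matrix.vecMul_transpose]
    simp [mulE]
  rw [e, Real.sqrt_sq (norm_nonneg _)]

end LinearAlgebra

/-! ### Triangulated polyhedra and piecewise affine functions -/

section Polyhedra

variable {d : ℕ} {𝒯 : Geometry.SimplicialComplex ℝ (E d)} {Ω : Set (E d)}

lemma IsTriangulation.isCompact_closure (hT : IsTriangulation 𝒯 Ω) : IsCompact (closure Ω) := by
  rw [← hT.space_eq, Geometry.SimplicialComplex.space]
  exact hT.finite.isCompact_biUnion fun s _ => s.finite_toSet.isCompact_convexHull ℝ

lemma IsTriangulation.exists_full_simplex (hT : IsTriangulation 𝒯 Ω) {z : E d}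
    (hz : z ∈ closure Ω) :
    ∃ t ∈ 𝒯.faces, t.card = d + 1 ∧ z ∈ convexHull ℝ (t : Set (E d)) := by
  rw [← hT.space_eq, Geometry.SimplicialComplex.mem_space_iff] at hz
  obtain ⟨s, hs, hzs⟩ := hz
  obtain ⟨t, ht, hst, hcard⟩ := hT.pure s hs
  exact ⟨t, ht, hcard, convexHull_mono (by exact_mod_cast hst) hzs⟩

/-- The `d + 1` affinely independent vertices of a full simplex span the space, so its hull has
interior. This ball is what makes `projError` a bound for the operator norm of `Id - P^ℓ`. -/
lemma IsBoundedPolyhedron.exists_ball_subset (hΩ : IsBoundedPolyhedron Ω) :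
    ∃ (c : E d) (r : ℝ), 0 < r ∧ Metric.closedBall c r ⊆ closure Ω := by
  obtain ⟨⟨y, hy⟩, 𝒯, hT⟩ := hΩ
  obtain ⟨t, ht, hcard, -⟩ := hT.exists_full_simplex (subset_closure hy)
  have hspan : affineSpan ℝ (t : Set (E d)) = ⊤ := by
    have hind := 𝒯.indep ht
    have := hind.affineSpan_eq_top_iff_card_eq_finrank_add_one.2 (by simp [hcard])
    simpa using this
  obtain ⟨c, hc⟩ := interior_convexHull_nonempty_iff_affineSpan_eq_top.2 hspan
  obtain ⟨r, hr, hball⟩ := Metric.nhds_basis_closedBall.mem_iff.1 (mem_interior_iff_mem_nhds.1 hc)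
  refine ⟨c, r, hr, hball.trans ?_⟩
  rw [← hT.space_eq]
  exact Geometry.SimplicialComplex.convexHull_subset_space ht

lemma IsTriangulation.dist_le_meshSize (hT : IsTriangulation 𝒯 Ω) {t : Finset (E d)}
    (ht : t ∈ 𝒯.faces) (hcard : t.card = d + 1) {x y : E d}
    (hx : x ∈ convexHull ℝ (t : Set (E d))) (hy : y ∈ convexHull ℝ (t : Set (E d))) :
    ‖x - y‖ ≤ meshSize 𝒯 := by
  rw [← dist_eq_norm]
  refine (Metric.dist_le_diam_of_mem (t.finite_toSet.isCompact_convexHull ℝ).isBounded hx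
    hy).trans (le_csSup ?_ ⟨t, ht, hcard, rfl⟩)
  refine ((hT.finite.image fun s : Finset (E d) => Metric.diam (convexHull ℝ (s : Set (E d)))).subset ?_).bddAbove
  rintro _ ⟨s, hs, -, rfl⟩
  exact ⟨s, hs, rfl⟩

/-- On each simplex, a piecewise affine function is compared with its values at two vertices. -/
lemma IsTriangulation.exists_vertices (hT : IsTriangulation 𝒯 Ω) {w : E d → ℝ}
    (hw : IsPiecewiseAffine 𝒯 Ω w) {z : E d} (hz : z ∈ closure Ω) :
    (∃ x ∈ 𝒯.vertices, ‖x - z‖ ≤ meshSize 𝒯 ∧ w z ≤ w x) ∧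
      ∃ x ∈ 𝒯.vertices, ‖x - z‖ ≤ meshSize 𝒯 ∧ w x ≤ w z := by
  obtain ⟨t, ht, hcard, hzt⟩ := hT.exists_full_simplex hz
  obtain ⟨a, ha⟩ := hw.2 t ht hcard
  have hvert : ∀ x ∈ (t : Set (E d)), x ∈ 𝒯.vertices := fun x hx =>
    𝒯.down_closed ht (by simpa using hx) (Finset.singleton_nonempty x)
  have hconv : ConvexOn ℝ univ a := by
    have := (convexOn_id (𝕜 := ℝ) (β := ℝ) convex_univ).comp_affineMap a
    simpa using this
  have hconc : ConcaveOn ℝ univ a := by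
    have := (concaveOn_id (𝕜 := ℝ) (β := ℝ) convex_univ).comp_affineMap a
    simpa using this
  obtain ⟨x, hx, hle⟩ := hconv.exists_ge_of_mem_convexHull (subset_univ _) hzt
  obtain ⟨x', hx', hle'⟩ := hconc.exists_le_of_mem_convexHull (subset_univ _) hzt
  have hxt := subset_convexHull ℝ _ hx
  have hxt' := subset_convexHull ℝ _ hx'
  refine ⟨⟨x, hvert x hx, hT.dist_le_meshSize ht hcard hxt hzt, ?_⟩,
    x', hvert x' hx', hT.dist_le_meshSize ht hcard hxt' hzt, ?_⟩
  · rw [ha hzt, ha hxt]; exact hle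
  · rw [ha hzt, ha hxt']; exact hle'

lemma IsTriangulation.vertices_subset (hT : IsTriangulation 𝒯 Ω) {z : E d} (hz : z ∈ 𝒯.vertices) :
    z ∈ closure Ω := by
  rw [← hT.space_eq]
  exact Geometry.SimplicialComplex.subset_space hz (by simp)

end Polyhedra

/-! ### The projection error as an operator norm bound -/

section ProjectionError

variable {n l : ℕ} {Mm : Matrix (Fin n) (Fin n) ℝ} {Ψ : Matrix (Fin n) (Fin l) ℝ} {Ω : Set (E n)}

lemma proj_add (x y : E n) : proj Mm Ψ (x + y) = proj Mm Ψ x + proj Mm Ψ y := mulE_add _ _ _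

lemma proj_smul (c : ℝ) (y : E n) : proj Mm Ψ (c • y) = c • proj Mm Ψ y := mulE_smul _ _ _

lemma norm_sub_proj_le_projError (hcomp : IsCompact (closure Ω)) {y : E n} (hy : y ∈ closure Ω) :
    ‖y - proj Mm Ψ y‖ ≤ projError Mm Ψ Ω := by
  refine le_csSup (hcomp.bddAbove_image ?_) ⟨y, hy, rfl⟩
  have : Continuous fun y : E n => ‖y - proj Mm Ψ y‖ := by
    simp only [proj, mulE_eq]; fun_prop
  exact this.continuousOn

/-- As `closure Ω` contains a ball, the projection error on `closure Ω` controls the norm of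
`Id - P^ℓ`. -/
lemma norm_sub_proj_le (hcomp : IsCompact (closure Ω)) {c : E n} {r : ℝ} (hr : 0 < r)
    (hball : Metric.closedBall c r ⊆ closure Ω) (x : E n) :
    ‖x - proj Mm Ψ x‖ ≤ 2 / r * projError Mm Ψ Ω * ‖x‖ := by
  by_cases hx : x = 0
  · subst hx; simp [proj, mulE_eq]
  have hnx : 0 < ‖x‖ := norm_pos_iff.2 hx
  have h1 := norm_sub_proj_le_projError (Mm := Mm) (Ψ := Ψ) hcomp
    (hball (Metric.mem_closedBall_self hr.le))
  have h2 := norm_sub_proj_le_projError (Mm := Mm) (Ψ := Ψ) hcomp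
    (hball (show c + (r / ‖x‖) • x ∈ Metric.closedBall c r by
      simp [norm_smul, abs_of_pos hr, hnx.ne']))
  -- The vector `x`, scaled to length `r`, is the difference of two points of the ball; this is the
  -- source of the factor `2 / r`.
  have e : (r / ‖x‖) • (x - proj Mm Ψ x) = (c + (r / ‖x‖) • x - proj Mm Ψ (c + (r / ‖x‖) • x))
      - (c - proj Mm Ψ c) := by
    rw [proj_add, proj_smul]; module
  have h3 : r / ‖x‖ * ‖x - proj Mm Ψ x‖ ≤ 2 * projError Mm Ψ Ω := by
    calc r / ‖x‖ * ‖x - proj Mm Ψ x‖ = ‖(r / ‖x‖) • (x - proj Mm Ψ x)‖ := by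
          rw [norm_smul, Real.norm_eq_abs, abs_of_pos (by positivity)]
      _ ≤ projError Mm Ψ Ω + projError Mm Ψ Ω := by
          rw [e]; exact (norm_sub_le _ _).trans (add_le_add h2 h1)
      _ = _ := by ring
  calc ‖x - proj Mm Ψ x‖ = (r / ‖x‖ * ‖x - proj Mm Ψ x‖) * (‖x‖ / r) := by
        field_simp
    _ ≤ 2 * projError Mm Ψ Ω * (‖x‖ / r) := by gcongr
    _ = _ := by ring

lemma projError_nonneg : 0 ≤ projError Mm Ψ Ω := by
  refine Real.sSup_nonneg ?_
  rintro _ ⟨y, -, rfl⟩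
  exact norm_nonneg _

end ProjectionError

/-! ### Euler iterates and discrete discounted costs -/

section DiscreteCost

variable {n m : ℕ}

/-- The explicit Euler iterates for `ẏ = f(y,u)` with step size `h`. -/
def eulerSeq (f : E n → E m → E n) (h : ℝ) (u : ℕ → E m) (y₀ : E n) : ℕ → E n
  | 0 => y₀
  | k + 1 => eulerSeq f h u y₀ k + h • f (eulerSeq f h u y₀ k) (u k)

/-- The discrete discounted cost over `N` steps along the Euler iterates. -/
def discCost (f : E n → E m → E n) (g : E n → E m → ℝ) (lam h : ℝ) (N : ℕ) (u : ℕ → E m)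
    (y₀ : E n) : ℝ :=
  ∑ k ∈ Finset.range N, h * (1 - lam * h) ^ k * g (eulerSeq f h u y₀ k) (u k)

variable {f : E n → E m → E n} {g : E n → E m → ℝ} {U : Set (E m)} {lam h L Lg : ℝ}

lemma eulerSeq_shift (u : ℕ → E m) (y₀ : E n) (k : ℕ) :
    eulerSeq f h u y₀ (k + 1)
      = eulerSeq f h (fun i => u (i + 1)) (y₀ + h • f y₀ (u 0)) k := by
  induction k with
  | zero => rfl
  | succ k ih => rw [eulerSeq, ih, eulerSeq]

/-- Dynamic programming for the discrete cost: the recursion has the form of the scheme, which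
allows an induction on the horizon. -/
lemma discCost_succ (N : ℕ) (u : ℕ → E m) (y₀ : E n) :
    discCost f g lam h (N + 1) u y₀ = h * g y₀ (u 0)
      + (1 - lam * h) * discCost f g lam h N (fun i => u (i + 1)) (y₀ + h • f y₀ (u 0)) := by
  rw [discCost, Finset.sum_range_succ', discCost, Finset.mul_sum, add_comm]
  congr 1
  · simp [eulerSeq]
  · refine Finset.sum_congr rfl fun k _ => ?_
    rw [eulerSeq_shift]; ring

/-- The discrete cost is Lipschitz continuous in the initial state, uniformly in the step size. -/
lemma abs_discCost_sub_le (hf : ∀ y y' : E n, ∀ u ∈ U, ‖f y u - f y' u‖ ≤ L * ‖y - y'‖)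
    (hg : ∀ y y' : E n, ∀ u ∈ U, |g y u - g y' u| ≤ Lg * ‖y - y'‖)
    (hL : 0 ≤ L) (hLg : 0 ≤ Lg) (hlam : L < lam) (hh : 0 < h) (hh1 : lam * h < 1) (N : ℕ) :
    ∀ (u : ℕ → E m), (∀ k, u k ∈ U) → ∀ y y' : E n,
      |discCost f g lam h N u y - discCost f g lam h N u y'| ≤ Lg / (lam - L) * ‖y - y'‖ := by
  have hd : 0 < lam - L := by linarith
  induction N with
  | zero =>
    intro u _ y y'
    simp only [discCost, Finset.range_zero, Finset.sum_empty, sub_self, abs_zero]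
    positivity
  | succ N ih =>
    intro u hu y y'
    rw [discCost_succ, discCost_succ]
    set K := Lg / (lam - L) with hK
    have hK0 : 0 ≤ K := by positivity
    -- The constant is chosen so that `h * Lg + (1 - lam * h) * (1 + h * L) * K` equals `K - lam * h
    -- ^ 2 * L * K`; hence `K` is preserved at every step, for any horizon.
    have hKL : K * (lam - L) = Lg := by rw [hK]; field_simp
    have h1 := ih (fun i => u (i + 1)) (fun k => hu _) (y + h • f y (u 0)) (y' + h • f y' (u 0))
    have h2 : ‖y + h • f y (u 0) - (y' + h • f y' (u 0))‖ ≤ (1 + h * L) * ‖y - y'‖ := by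
      have e : y + h • f y (u 0) - (y' + h • f y' (u 0))
          = (y - y') + h • (f y (u 0) - f y' (u 0)) := by module
      rw [e]
      refine (norm_add_le _ _).trans ?_
      rw [norm_smul, Real.norm_eq_abs, abs_of_pos hh]
      have := mul_le_mul_of_nonneg_left (hf y y' _ (hu 0)) hh.le
      linarith
    have h3 := hg y y' _ (hu 0)
    set a := discCost f g lam h N (fun i => u (i + 1)) (y + h • f y (u 0))
    set b := discCost f g lam h N (fun i => u (i + 1)) (y' + h • f y' (u 0))
    have hβ : 0 ≤ 1 - lam * h := by linarith
    calc |h * g y (u 0) + (1 - lam * h) * a - (h * g y' (u 0) + (1 - lam * h) * b)|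
        = |h * (g y (u 0) - g y' (u 0)) + (1 - lam * h) * (a - b)| := by ring_nf
      _ ≤ h * |g y (u 0) - g y' (u 0)| + (1 - lam * h) * |a - b| := by
          refine (abs_add_le _ _).trans ?_
          rw [abs_mul, abs_mul, abs_of_pos hh, abs_of_nonneg hβ]
      _ ≤ h * (Lg * ‖y - y'‖) + (1 - lam * h) * (K * ((1 + h * L) * ‖y - y'‖)) := by
          gcongr
          exact h1.trans (by gcongr)
      _ = K * ‖y - y'‖ - lam * h ^ 2 * L * K * ‖y - y'‖ := by rw [← hKL]; ring
      _ ≤ K * ‖y - y'‖ := by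
          have : 0 < lam := by linarith
          have : 0 ≤ lam * h ^ 2 * L * K * ‖y - y'‖ := by positivity
          linarith

end DiscreteCost

/-! ### The fully discrete scheme against discrete costs -/

section Scheme

variable {n m l : ℕ} {f : E n → E m → E n} {g : E n → E m → ℝ} {U : Set (E m)}
  {lam h L Lg : ℝ} {Mm : Matrix (Fin n) (Fin n) ℝ} {Ψ : Matrix (Fin n) (Fin l) ℝ}
  {Ωl : Set (E l)} {𝒯 : Geometry.SimplicialComplex ℝ (E l)} {w : E l → ℝ}

/-- Comparison of the solution of the fully discrete scheme with the discrete costs in the full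
space. -/
theorem IsSchemeSolution.compare_discCost
    (hf : ∀ y y' : E n, ∀ u ∈ U, ‖f y u - f y' u‖ ≤ L * ‖y - y'‖)
    (hg : ∀ y y' : E n, ∀ u ∈ U, |g y u - g y' u| ≤ Lg * ‖y - y'‖)
    (hL : 0 < L) (hLg : 0 ≤ Lg) (hlam : L < lam) (hh : 0 < h) (hh1 : lam * h < 1)
    (hT : IsTriangulation 𝒯 Ωl) (hw : IsSchemeSolution f g lam U Mm Ψ Ωl 𝒯 h w)
    {B η δ : ℝ} (hB : ∀ z ∈ closure Ωl, |w z| ≤ B)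
    (hη : ∀ z ∈ closure Ωl, ∀ u ∈ U,
      ‖f (mulE Ψ z) u - proj Mm Ψ (f (mulE Ψ z) u)‖ ≤ η)
    (hδ : δ = Lg / (lam - L) * (specNorm Ψ * meshSize 𝒯) + Lg / (lam - L) * (h * η))
    (hU : U.Nonempty) (N : ℕ) :
    ∀ z ∈ closure Ωl,
      (∀ u : ℕ → E m, (∀ k, u k ∈ U) → w z ≤ discCost f g lam h N u (mulE Ψ z)
        + ((1 - lam * h) ^ N * B + δ / (lam * h))) ∧
      ∃ u : ℕ → E m, (∀ k, u k ∈ U) ∧ discCost f g lam h N u (mulE Ψ z) ≤ w z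
        + ((1 - lam * h) ^ N * B + δ / (lam * h)) := by
  have hlip := abs_discCost_sub_le hf hg hL.le hLg hlam hh hh1
  have hd : 0 < lam - L := by linarith
  have hl0 : 0 < lam := by linarith
  set K := Lg / (lam - L) with hK
  have hK0 : 0 ≤ K := by positivity
  have hβ : 0 ≤ 1 - lam * h := by linarith
  -- `δ / (lam * h)` is the fixed point of `e ↦ (1 - lam * h) * e + δ`, the recursion satisfied by
  -- the error when each step adds `δ`.
  have hstep : ∀ N : ℕ, (1 - lam * h) ^ (N + 1) * B + δ / (lam * h)
      = (1 - lam * h) * ((1 - lam * h) ^ N * B + δ / (lam * h)) + δ := by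
    intro N; field_simp; ring
  -- perturbation of the initial state within a simplex and by the projection of the dynamics
  have hmesh : ∀ N (u : ℕ → E m), (∀ k, u k ∈ U) → ∀ x z : E l, ‖x - z‖ ≤ meshSize 𝒯 →
      |discCost f g lam h N u (mulE Ψ x) - discCost f g lam h N u (mulE Ψ z)|
        ≤ K * (specNorm Ψ * meshSize 𝒯) := by
    intro N u hu x z hxz
    refine (hlip N u hu _ _).trans (mul_le_mul_of_nonneg_left ?_ hK0)
    rw [← mulE_sub]
    exact (norm_mulE_le _ _).trans (mul_le_mul_of_nonneg_left hxz (specNorm_nonneg _))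
  have hdyn : ∀ N (u : ℕ → E m), (∀ k, u k ∈ U) → ∀ x ∈ closure Ωl, ∀ v ∈ U,
      |discCost f g lam h N u (mulE Ψ (x + h • redDyn Mm Ψ f x v))
        - discCost f g lam h N u (mulE Ψ x + h • f (mulE Ψ x) v)| ≤ K * (h * η) := by
    intro N u hu x hx v hv
    refine (hlip N u hu _ _).trans (mul_le_mul_of_nonneg_left ?_ hK0)
    have e : mulE Ψ (x + h • redDyn Mm Ψ f x v) - (mulE Ψ x + h • f (mulE Ψ x) v)
        = -(h • (f (mulE Ψ x) v - proj Mm Ψ (f (mulE Ψ x) v))) := by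
      rw [mulE_add, mulE_smul, mulE_redDyn]; module
    rw [e, norm_neg, norm_smul, Real.norm_eq_abs, abs_of_pos hh]
    exact mul_le_mul_of_nonneg_left (hη x hx v hv) hh.le
  have hscale : ∀ c : ℝ, 0 ≤ c → (1 - lam * h) * c ≤ c := fun c hc => by
    have : 0 ≤ lam * h * c := by positivity
    linarith
  induction N with
  | zero =>
    obtain ⟨u₀, hu₀⟩ := hU
    intro z hz
    have hBz := abs_le.1 (hB z hz)
    have hmesh0 : 0 ≤ K * (specNorm Ψ * meshSize 𝒯) := by
      obtain ⟨⟨x, -, hx, -⟩, -⟩ := hT.exists_vertices hw.affine hz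
      exact mul_nonneg hK0 (mul_nonneg (specNorm_nonneg _) ((norm_nonneg _).trans hx))
    have hη0 : 0 ≤ η := (norm_nonneg _).trans (hη z hz u₀ hu₀)
    have : 0 ≤ δ / (lam * h) := by
      have : 0 ≤ δ := by rw [hδ]; positivity
      positivity
    simp only [discCost, Finset.range_zero, Finset.sum_empty, pow_zero, one_mul]
    exact ⟨fun u _ => by linarith, fun _ => u₀, fun _ => hu₀, by linarith⟩
  | succ N ih =>
    intro z hz
    -- `x` serves the upper bound on `w z`, with the given first control; `x'` serves the lower
    -- bound, with the minimising control at `x'` put in front of the sequence from the induction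
    -- hypothesis.
    obtain ⟨⟨x, hx, hxz, hwx⟩, x', hx', hxz', hwx'⟩ := hT.exists_vertices hw.affine hz
    rw [hstep]
    constructor
    · intro u hu
      have h1 := (hw.eq_min x hx).2 ⟨u 0, hu 0, rfl⟩
      have hxc := hT.vertices_subset hx
      have hu' : ∀ k, (fun i => u (i + 1)) k ∈ U := fun k => hu _
      have h2 := (ih _ (hw.mem x hx _ (hu 0))).1 _ hu'
      have h3 := abs_le.1 (hdyn N _ hu' x hxc _ (hu 0))
      have h4 := abs_le.1 (hmesh (N + 1) u hu x z hxz)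
      have h5 := mul_le_mul_of_nonneg_left (h2.trans (add_le_add_left (sub_le_iff_le_add.1 h3.2) _))
        hβ
      have h6 := hscale (K * (h * η)) ((abs_nonneg _).trans (hdyn N _ hu' x hxc _ (hu 0)))
      have h7 := discCost_succ (f := f) (g := g) (lam := lam) (h := h) N u (mulE Ψ x)
      simp only [redCost] at h1
      rw [mul_add, mul_add] at h5
      linarith [h4.2]
    · obtain ⟨u₀, hu₀, hmin⟩ := (hw.eq_min x' hx').1
      obtain ⟨u', hu', h2⟩ := (ih _ (hw.mem x' hx' _ hu₀)).2
      let u : ℕ → E m := fun k => Nat.casesOn k u₀ u'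
      have hu : ∀ k, u k ∈ U := fun k => by
        cases k with
        | zero => exact hu₀
        | succ k => exact hu' k
      refine ⟨u, hu, ?_⟩
      have hxc := hT.vertices_subset hx'
      have h3 := abs_le.1 (hdyn N _ hu' x' hxc _ hu₀)
      have h4 := abs_le.1 (hmesh (N + 1) u hu x' z hxz')
      have h5 := mul_le_mul_of_nonneg_left ((neg_le_sub_iff_le_add.1 h3.1).trans
        (add_le_add_left h2 _)) hβ
      have h6 := hscale (K * (h * η)) ((abs_nonneg _).trans (hdyn N _ hu' x' hxc _ hu₀))
      have h7 : discCost f g lam h (N + 1) u (mulE Ψ x') = h * g (mulE Ψ x') u₀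
          + (1 - lam * h) * discCost f g lam h N u' (mulE Ψ x' + h • f (mulE Ψ x') u₀) :=
        discCost_succ N u (mulE Ψ x')
      simp only [redCost] at hmin
      rw [mul_add, mul_add] at h5
      linarith [h4.1]

end Scheme

/-! ### Discount factors and Gronwall inequalities with exponential weights -/

section ExponentialWeights

lemma exp_neg_le_one_sub_half {x : ℝ} (hx0 : 0 ≤ x) (hx : x ≤ 1) : Real.exp (-x) ≤ 1 - x / 2 := by
  have h1 : 1 + x ≤ Real.exp x := by linarith [Real.add_one_le_exp x]
  rw [Real.exp_neg]
  calc (Real.exp x)⁻¹ ≤ (1 + x)⁻¹ := inv_anti₀ (by linarith) h1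
    _ ≤ 1 - x / 2 := by
      rw [inv_le_iff_one_le_mul₀ (by linarith)]; nlinarith

lemma sum_exp_neg_le {κ h : ℝ} (hκ : 0 < κ) (hh : 0 < h) (hκh : κ * h ≤ 1) (N : ℕ) :
    ∑ k ∈ Finset.range N, h * Real.exp (-(κ * (k * h))) ≤ 2 / κ := by
  -- The right-hand side telescopes, and `1 - exp (-x) ≥ x / 2` on `[0, 1]` bounds each summand by
  -- its increment.
  have key : ∑ k ∈ Finset.range N, h * Real.exp (-(κ * (k * h)))
      ≤ 2 / κ * (1 - Real.exp (-(κ * (N * h)))) := by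
    induction N with
    | zero => simp
    | succ N ih =>
      rw [Finset.sum_range_succ]
      have e : Real.exp (-(κ * ((N + 1 : ℕ) * h)))
          = Real.exp (-(κ * (N * h))) * Real.exp (-(κ * h)) := by
        rw [← Real.exp_add]; push_cast; ring_nf
      have h1 := exp_neg_le_one_sub_half (x := κ * h) (by positivity) hκh
      have h2 : h ≤ 2 / κ * (1 - Real.exp (-(κ * h))) := by
        calc h = 2 / κ * (κ * h / 2) := by field_simp
          _ ≤ _ := by gcongr; linarith
      have h3 := mul_le_mul_of_nonneg_right h2 (Real.exp_pos (-(κ * (N * h)))).le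
      rw [e]
      calc _ ≤ 2 / κ * (1 - Real.exp (-(κ * (N * h))))
            + 2 / κ * (1 - Real.exp (-(κ * h))) * Real.exp (-(κ * (N * h))) := add_le_add ih h3
        _ = _ := by ring
  refine key.trans ?_
  have := Real.exp_pos (-(κ * (N * h)))
  have : 2 / κ * (1 - Real.exp (-(κ * (N * h)))) ≤ 2 / κ * 1 := by gcongr; linarith
  linarith

lemma sum_exp_le {μ h : ℝ} (hμ : 0 < μ) (k : ℕ) :
    ∑ j ∈ Finset.range k, h * Real.exp (μ * (j * h)) ≤ Real.exp (μ * (k * h)) / μ := by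
  induction k with
  | zero => simp; positivity
  | succ k ih =>
    rw [Finset.sum_range_succ]
    have e : Real.exp (μ * ((k + 1 : ℕ) * h))
        = Real.exp (μ * (k * h)) * Real.exp (μ * h) := by
      rw [← Real.exp_add]; push_cast; ring_nf
    have h1 := Real.add_one_le_exp (μ * h)
    have h2 := mul_le_mul_of_nonneg_left h1 (Real.exp_pos (μ * (k * h))).le
    rw [e, le_div_iff₀ hμ]
    rw [le_div_iff₀ hμ] at ih
    nlinarith

lemma one_sub_pow_le_exp {lam h : ℝ} (h1 : lam * h ≤ 1) (k : ℕ) :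
    (1 - lam * h) ^ k ≤ Real.exp (-(lam * (k * h))) := by
  have h2 : 1 - lam * h ≤ Real.exp (-(lam * h)) := by
    have := Real.add_one_le_exp (-(lam * h)); linarith
  calc (1 - lam * h) ^ k ≤ Real.exp (-(lam * h)) ^ k := pow_le_pow_left₀ (by linarith) h2 k
    _ = _ := by rw [← Real.exp_nat_mul]; ring_nf

/-- Telescoping `a ^ k - b ^ k` gives `k` one-step errors, each of order `(lam * h) ^ 2`. The factor
`exp 1` restores the power of `exp (-(lam * h))` lost in a step, since `exp 1 * exp (-(lam * h)) ≥
1`. -/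
lemma exp_pow_sub_pow_le {lam h : ℝ} (h0 : 0 ≤ lam * h) (h1 : lam * h ≤ 1) (k : ℕ) :
    Real.exp (-(lam * (k * h))) - (1 - lam * h) ^ k
      ≤ k * (lam * h) ^ 2 * Real.exp 1 * Real.exp (-(lam * (k * h))) := by
  induction k with
  | zero => simp
  | succ k ih =>
    have e : Real.exp (-(lam * ((k + 1 : ℕ) * h)))
        = Real.exp (-(lam * (k * h))) * Real.exp (-(lam * h)) := by
      rw [← Real.exp_add]; push_cast; ring_nf
    have ha : Real.exp (-(lam * h)) - (1 - lam * h) ≤ (lam * h) ^ 2 := by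
      have := Real.abs_exp_sub_one_sub_id_le (x := -(lam * h)) (by rw [abs_neg, abs_of_nonneg h0]; exact h1)
      have := (abs_le.1 this).2
      nlinarith
    have hae : 1 ≤ Real.exp 1 * Real.exp (-(lam * h)) := by
      rw [← Real.exp_add]; exact Real.one_le_exp (by linarith)
    set a := Real.exp (-(lam * h))
    set A := Real.exp (-(lam * (k * h)))
    have hA : 0 < A := Real.exp_pos _
    have ha0 : 0 < a := Real.exp_pos _
    have hb := one_sub_pow_le_exp h1 k
    have hb0 : 0 ≤ (1 - lam * h) ^ k := pow_nonneg (by linarith) k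
    rw [e, pow_succ]
    calc A * a - (1 - lam * h) ^ k * (1 - lam * h)
        = (A - (1 - lam * h) ^ k) * a + (1 - lam * h) ^ k * (a - (1 - lam * h)) := by ring
      _ ≤ (k * (lam * h) ^ 2 * Real.exp 1 * A) * a + A * (lam * h) ^ 2 := by
          have h2 : 0 ≤ a - (1 - lam * h) := by
            have := Real.add_one_le_exp (-(lam * h)); simp only [a]; linarith
          exact add_le_add (mul_le_mul_of_nonneg_right ih ha0.le) (mul_le_mul hb ha h2 hA.le)
      _ ≤ (k * (lam * h) ^ 2 * Real.exp 1 * A) * a + A * (lam * h) ^ 2 * (Real.exp 1 * a) :=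
          add_le_add_right (le_mul_of_one_le_right (by positivity) hae) _
      _ = _ := by push_cast; ring

/-- Comparison of the continuous and of the discrete discount factor on one time step. -/
lemma abs_exp_sub_pow_le {lam κ h : ℝ} (hlam : 0 < lam) (hκ : 0 < κ) (hh : 0 < h)
    (h1 : lam * h ≤ 1) (k : ℕ) {s : ℝ} (hs : k * h ≤ s) (hs' : s ≤ (k + 1 : ℕ) * h) :
    |Real.exp (-(lam * s)) - (1 - lam * h) ^ k|
      ≤ (lam + Real.exp 1 * lam ^ 2 / κ) * h * Real.exp (-((lam - κ) * (k * h))) := by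
  set t : ℝ := k * h with ht
  have ht0 : 0 ≤ t := by positivity
  have hA : Real.exp (-(lam * t)) ≤ Real.exp (-((lam - κ) * t)) :=
    Real.exp_le_exp.2 (by nlinarith)
  have h2 : Real.exp (-(lam * s)) ≤ Real.exp (-(lam * t)) := Real.exp_le_exp.2 (by nlinarith)
  have h3 : Real.exp (-(lam * t)) - Real.exp (-(lam * s)) ≤ lam * h * Real.exp (-(lam * t)) := by
    have e : Real.exp (-(lam * s)) = Real.exp (-(lam * t)) * Real.exp (-(lam * (s - t))) := by
      rw [← Real.exp_add]; ring_nf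
    have h4 := Real.add_one_le_exp (-(lam * (s - t)))
    have h5 : s - t ≤ h := by push_cast at hs'; rw [ht]; linarith
    have h6 : 1 - lam * h ≤ Real.exp (-(lam * (s - t))) := by nlinarith
    rw [e]
    nlinarith [Real.exp_pos (-(lam * t))]
  have h4 := exp_pow_sub_pow_le (by positivity) h1 k
  have h5 := one_sub_pow_le_exp h1 k
  rw [← ht] at h4 h5
  -- The linear growth in `k` is absorbed by giving up `κ` in the decay rate; this turns `k * h ^ 2`
  -- into `h / κ`.
  have h6 : κ * t * Real.exp (-(lam * t)) ≤ Real.exp (-((lam - κ) * t)) := by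
    have e : Real.exp (-((lam - κ) * t)) = Real.exp (κ * t) * Real.exp (-(lam * t)) := by
      rw [← Real.exp_add]; ring_nf
    rw [e]
    gcongr
    linarith [Real.add_one_le_exp (κ * t)]
  have h7 : k * (lam * h) ^ 2 * Real.exp 1 * Real.exp (-(lam * t))
      ≤ Real.exp 1 * lam ^ 2 / κ * h * Real.exp (-((lam - κ) * t)) := by
    calc k * (lam * h) ^ 2 * Real.exp 1 * Real.exp (-(lam * t))
        = Real.exp 1 * lam ^ 2 / κ * h * (κ * t * Real.exp (-(lam * t))) := by
          rw [ht]; field_simp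
      _ ≤ _ := by gcongr
  have h8 : lam * h * Real.exp (-(lam * t)) ≤ lam * h * Real.exp (-((lam - κ) * t)) := by gcongr
  have h9 : 0 ≤ Real.exp 1 * lam ^ 2 / κ * h * Real.exp (-((lam - κ) * t)) := by positivity
  have h10 : 0 ≤ lam * h * Real.exp (-((lam - κ) * t)) := by positivity
  rw [abs_le, add_mul, add_mul]
  constructor <;> linarith

/-- Discounted sums of exponentially growing terms. -/
lemma sum_discount_le {lam κ μ h : ℝ} (hκ : 0 < κ) (hμ : 0 ≤ μ) (hlam : μ + κ ≤ lam) (hh : 0 < h)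
    (h1 : lam * h ≤ 1) (N : ℕ) :
    ∑ k ∈ Finset.range N, h * ((1 - lam * h) ^ k * Real.exp (μ * (k * h))) ≤ 2 / κ := by
  refine (Finset.sum_le_sum fun k _ => ?_).trans (sum_exp_neg_le hκ hh (by nlinarith) N)
  gcongr
  calc (1 - lam * h) ^ k * Real.exp (μ * (k * h))
      ≤ Real.exp (-(lam * (k * h))) * Real.exp (μ * (k * h)) := by
        gcongr; exact one_sub_pow_le_exp h1 k
    _ = Real.exp ((μ - lam) * (k * h)) := by rw [← Real.exp_add]; ring_nf
    _ ≤ _ := by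
      refine Real.exp_le_exp.2 ?_
      have : 0 ≤ (k : ℝ) * h := by positivity
      nlinarith

/-- The ansatz `S * exp (μ * (k * h))` closes the induction because `S = A + L * S / μ`. The growth
rate may be any `μ > L`, with no restriction on how large `h` is. -/
lemma discrete_gronwall_exp {A L μ h : ℝ} (hA : 0 ≤ A) (hL : 0 ≤ L) (hμ : L < μ) (hh : 0 < h)
    {N : ℕ} (a : ℕ → ℝ)
    (ha : ∀ k ≤ N, a k ≤ A * Real.exp (μ * (k * h)) + h * L * ∑ j ∈ Finset.range k, a j) :
    ∀ k ≤ N, a k ≤ A * μ / (μ - L) * Real.exp (μ * (k * h)) := by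
  have hd : 0 < μ - L := by linarith
  have hμ0 : 0 < μ := by linarith
  set S := A * μ / (μ - L) with hS
  have hS0 : 0 ≤ S := by positivity
  have hSe : S = A + L * S / μ := by rw [hS]; field_simp; ring
  intro k
  induction k using Nat.strong_induction_on with
  | _ k ih =>
    intro hk
    refine (ha k hk).trans ?_
    have h1 : ∑ j ∈ Finset.range k, a j ≤ ∑ j ∈ Finset.range k, S * Real.exp (μ * (j * h)) :=
      Finset.sum_le_sum fun j hj => ih j (by simpa using hj) (by simp at hj; omega)
    have h2 := sum_exp_le (h := h) hμ0 k
    calc A * Real.exp (μ * (k * h)) + h * L * ∑ j ∈ Finset.range k, a j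
        ≤ A * Real.exp (μ * (k * h))
          + h * L * ∑ j ∈ Finset.range k, S * Real.exp (μ * (j * h)) := by gcongr
      _ = A * Real.exp (μ * (k * h))
          + L * S * ∑ j ∈ Finset.range k, h * Real.exp (μ * (j * h)) := by
          rw [← Finset.mul_sum, ← Finset.mul_sum]; ring
      _ ≤ A * Real.exp (μ * (k * h)) + L * S * (Real.exp (μ * (k * h)) / μ) := by gcongr
      _ = (A + L * S / μ) * Real.exp (μ * (k * h)) := by ring
      _ = _ := by rw [← hSe]

lemma integral_exp_mul_le {μ t : ℝ} (hμ : 0 < μ) :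
    ∫ s in (0 : ℝ)..t, Real.exp (μ * s) = (Real.exp (μ * t) - 1) / μ := by
  rw [intervalIntegral.integral_comp_mul_left (fun s => Real.exp s) hμ.ne', integral_exp]
  simp [div_eq_inv_mul]

/-- The inequality is evaluated where `exp (-(μ * t)) * φ t` is maximal on `[0, T]`; a positive
maximum `S` then satisfies `S ≤ A + L * S / μ`. -/
lemma integral_gronwall_exp {A L μ T : ℝ} (hA : 0 ≤ A) (hL : 0 ≤ L) (hμ : L < μ) (hT : 0 ≤ T)
    {φ : ℝ → ℝ} (hφc : ContinuousOn φ (Icc 0 T))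
    (hφ : ∀ t ∈ Icc 0 T, φ t ≤ A * Real.exp (μ * t) + L * ∫ s in (0 : ℝ)..t, φ s) :
    φ T ≤ A * μ / (μ - L) * Real.exp (μ * T) := by
  have hd : 0 < μ - L := by linarith
  have hμ0 : 0 < μ := by linarith
  obtain ⟨t, ht, hmax⟩ := isCompact_Icc.exists_isMaxOn (nonempty_Icc.2 hT)
    (show ContinuousOn (fun t => Real.exp (-(μ * t)) * φ t) (Icc 0 T) by fun_prop)
  set S := Real.exp (-(μ * t)) * φ t with hS
  have hbound : ∀ s ∈ Icc 0 T, φ s ≤ S * Real.exp (μ * s) := fun s hs => by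
    have h1 : Real.exp (-(μ * s)) * φ s ≤ S := hmax hs
    have h2 := mul_le_mul_of_nonneg_right h1 (Real.exp_pos (μ * s)).le
    have e : Real.exp (-(μ * s)) * Real.exp (μ * s) = 1 := by rw [← Real.exp_add]; simp
    calc φ s = Real.exp (-(μ * s)) * φ s * Real.exp (μ * s) := by
          rw [mul_right_comm, e, one_mul]
      _ ≤ _ := h2
  have hSle : S ≤ A * μ / (μ - L) := by
    rcases le_or_gt S 0 with hS0 | hS0
    · exact hS0.trans (by positivity)
    have h1 : ∫ s in (0 : ℝ)..t, φ s ≤ ∫ s in (0 : ℝ)..t, S * Real.exp (μ * s) := by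
      refine intervalIntegral.integral_mono_on ht.1 ?_ ?_ fun s hs => hbound s ⟨hs.1, hs.2.trans ht.2⟩
      · refine ContinuousOn.intervalIntegrable ?_
        rw [uIcc_of_le ht.1]
        exact hφc.mono (Icc_subset_Icc_right ht.2)
      · exact Continuous.intervalIntegrable (by fun_prop) _ _
    rw [intervalIntegral.integral_const_mul, integral_exp_mul_le hμ0] at h1
    have h2 := hφ t ht
    have h3 : φ t ≤ (A + L * S / μ) * Real.exp (μ * t) := by
      calc φ t ≤ A * Real.exp (μ * t) + L * (S * ((Real.exp (μ * t) - 1) / μ)) :=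
            h2.trans (by gcongr)
        _ = (A + L * S / μ) * Real.exp (μ * t) - L * S / μ := by ring
        _ ≤ _ := by
          have : 0 ≤ L * S / μ := by positivity
          linarith
    have e : Real.exp (-(μ * t)) * Real.exp (μ * t) = 1 := by rw [← Real.exp_add]; simp
    have h4 : S ≤ A + L * S / μ := by
      calc S ≤ Real.exp (-(μ * t)) * ((A + L * S / μ) * Real.exp (μ * t)) := by
            rw [hS]; gcongr
        _ = (A + L * S / μ) * (Real.exp (-(μ * t)) * Real.exp (μ * t)) := by ring
        _ = _ := by rw [e, mul_one]
    rw [le_div_iff₀ hd]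
    have h5 : S * μ ≤ A * μ + L * S := by
      calc S * μ ≤ (A + L * S / μ) * μ := by gcongr
        _ = _ := by field_simp
    linarith
  refine (hbound T ⟨hT, le_rfl⟩).trans ?_
  gcongr

/-- Control defects are small only in their prefix sums, not summed in absolute value. Summation by
parts transfers this to discounted sums, with the factor `1 - β = lam * h` compensating the number
of steps. -/
lemma abel_sum_discount (β : ℝ) (d : ℕ → ℝ) (N : ℕ) :
    ∑ k ∈ Finset.range N, β ^ k * d k = β ^ N * ∑ j ∈ Finset.range N, d j
      + (1 - β) * ∑ k ∈ Finset.range N, β ^ k * ∑ j ∈ Finset.range (k + 1), d j := by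
  induction N with
  | zero => simp
  | succ N ih =>
    rw [Finset.sum_range_succ, ih, Finset.sum_range_succ (fun k => β ^ k * _),
      Finset.sum_range_succ d N]
    ring

end ExponentialWeights

/-! ### Growth and time regularity of trajectories -/

section Trajectories

variable {n m : ℕ} {f : E n → E m → E n} {g : E n → E m → ℝ} {U : Set (E m)} {L Lg : ℝ}
  {u : ℝ → E m} {y : ℝ → E n} {y₀ : E n}

lemma aestronglyMeasurable_comp_traj {F : Type*} [NormedAddCommGroup F] {Φ : E n → E m → F}
    (hΦ : Continuous fun p : E n × E m => Φ p.1 p.2) (hy : ContinuousOn y (Ici 0))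
    (hu : AEStronglyMeasurable u (volume.restrict (Ioi 0))) :
    AEStronglyMeasurable (fun s => Φ (y s) (u s)) (volume.restrict (Ioi 0)) :=
  hΦ.comp_aestronglyMeasurable
    (((hy.mono Ioi_subset_Ici_self).aestronglyMeasurable measurableSet_Ioi).prodMk hu)

lemma ae_uIoc_of_ae_Ioi {P : ℝ → Prop} (h : ∀ᵐ s ∂(volume.restrict (Ioi (0 : ℝ))), P s) {a b : ℝ}
    (ha : 0 ≤ a) (hab : a ≤ b) : ∀ᵐ s, s ∈ uIoc a b → (a < s ∧ s ≤ b) ∧ P s := by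
  rw [ae_restrict_iff' measurableSet_Ioi] at h
  filter_upwards [h] with s hs hsab
  rw [uIoc_of_le hab] at hsab
  exact ⟨hsab, hs (ha.trans_lt hsab.1)⟩

lemma intervalIntegrable_of_ae_bound {F : Type*} [NormedAddCommGroup F] {φ : ℝ → F} {a b C : ℝ}
    (hm : AEStronglyMeasurable φ (volume.restrict (Ioi 0))) (ha : 0 ≤ a) (hab : a ≤ b)
    (hb : ∀ᵐ s, s ∈ uIoc a b → ‖φ s‖ ≤ C) : IntervalIntegrable φ volume a b := by
  rw [intervalIntegrable_iff_integrableOn_Ioc_of_le hab]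
  refine IntegrableOn.of_bound (by simp) ?_ C ?_
  · exact hm.mono_set (show Ioc a b ⊆ Ioi 0 from fun s hs => ha.trans_lt hs.1)
  · rw [ae_restrict_iff' measurableSet_Ioc]
    rwa [uIoc_of_le hab] at hb

lemma IsTrajectory.sub_eq (hy : IsTrajectory f u y₀ y) {a b : ℝ} (ha : 0 ≤ a) (hab : a ≤ b) :
    y b - y a = ∫ s in a..b, f (y s) (u s) := by
  rw [(hy.2 b (ha.trans hab)).2, (hy.2 a ha).2,
    ← intervalIntegral.integral_interval_sub_left (hy.2 b (ha.trans hab)).1 (hy.2 a ha).1]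
  abel

/-- Exponential growth of trajectories. -/
lemma IsTrajectory.norm_sub_initial_le (hy : IsTrajectory f u y₀ y)
    (hf : ∀ y y' : E n, ∀ u ∈ U, ‖f y u - f y' u‖ ≤ L * ‖y - y'‖)
    (huU : ∀ᵐ t ∂(volume.restrict (Ioi (0 : ℝ))), u t ∈ U) {F μ : ℝ} (hF0 : 0 ≤ F)
    (hF : ∀ v ∈ U, ‖f y₀ v‖ ≤ F) (hL : 0 ≤ L) (hμ : L < μ) {T : ℝ} (hT : 0 ≤ T) :
    ‖y T - y₀‖ ≤ F / (μ - L) * Real.exp (μ * T) := by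
  have hμ0 : 0 < μ := by linarith
  have hc : ContinuousOn (fun t => ‖y t - y₀‖) (Ici 0) := (hy.1.sub continuousOn_const).norm
  have h := integral_gronwall_exp (A := F / μ) (by positivity) hL hμ hT
    (φ := fun t => ‖y t - y₀‖) (hc.mono Icc_subset_Ici_self) ?_
  · refine h.trans_eq ?_
    field_simp
  intro t ht
  have hci : IntervalIntegrable (fun s => ‖y s - y₀‖) volume 0 t := by
    refine ContinuousOn.intervalIntegrable ?_
    rw [uIcc_of_le ht.1]; exact hc.mono Icc_subset_Ici_self
  have e : y t - y₀ = ∫ s in (0 : ℝ)..t, f (y s) (u s) := by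
    rw [(hy.2 t ht.1).2]; abel
  have h1 : ‖∫ s in (0 : ℝ)..t, f (y s) (u s)‖
      ≤ ∫ s in (0 : ℝ)..t, (F + L * ‖y s - y₀‖) := by
    refine intervalIntegral.norm_integral_le_of_norm_le ht.1 ?_
      (intervalIntegrable_const.add (hci.const_mul L))
    have := ae_uIoc_of_ae_Ioi huU le_rfl ht.1
    rw [uIoc_of_le ht.1] at this
    filter_upwards [this] with s hs hsI
    have hsU := (hs hsI).2
    calc ‖f (y s) (u s)‖ = ‖f y₀ (u s) + (f (y s) (u s) - f y₀ (u s))‖ := by congr 1; abel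
      _ ≤ _ := (norm_add_le _ _).trans (add_le_add (hF _ hsU) (hf _ _ _ hsU))
  rw [intervalIntegral.integral_add intervalIntegrable_const (hci.const_mul L),
    intervalIntegral.integral_const_mul, intervalIntegral.integral_const, smul_eq_mul,
    sub_zero] at h1
  simp only [e]
  refine h1.trans ?_
  have h2 : t * F ≤ F / μ * Real.exp (μ * t) := by
    calc t * F = F / μ * (μ * t) := by field_simp
      _ ≤ _ := by gcongr; linarith [Real.add_one_le_exp (μ * t)]
  linarith

/-- A bound at the initial state alone suffices: Lipschitz continuity carries it along the
trajectory at the same exponential rate, so trajectories need not stay in `closure Ω`. -/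
lemma norm_le_of_growth {F' : Type*} [NormedAddCommGroup F'] {Φ : E n → E m → F'} {K B C μ t : ℝ}
    (hΦ : ∀ y y' : E n, ∀ u ∈ U, ‖Φ y u - Φ y' u‖ ≤ K * ‖y - y'‖) (hK : 0 ≤ K) (hB0 : 0 ≤ B)
    (hB : ∀ v ∈ U, ‖Φ y₀ v‖ ≤ B) (hμ : 0 ≤ μ) (ht : 0 ≤ t) {x : E n}
    (hx : ‖x - y₀‖ ≤ C * Real.exp (μ * t)) :
    ∀ v ∈ U, ‖Φ x v‖ ≤ (B + K * C) * Real.exp (μ * t) := by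
  intro v hv
  have h1 : 1 ≤ Real.exp (μ * t) := Real.one_le_exp (by positivity)
  calc ‖Φ x v‖ = ‖Φ y₀ v + (Φ x v - Φ y₀ v)‖ := by congr 1; abel
    _ ≤ B + K * (C * Real.exp (μ * t)) :=
        (norm_add_le _ _).trans (add_le_add (hB v hv) ((hΦ _ _ _ hv).trans (by gcongr)))
    _ ≤ B * Real.exp (μ * t) + K * (C * Real.exp (μ * t)) := by
        gcongr; exact le_mul_of_one_le_right hB0 h1
    _ = _ := by ring

lemma IsTrajectory.norm_sub_le_mul (hy : IsTrajectory f u y₀ y)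
    (huU : ∀ᵐ t ∂(volume.restrict (Ioi (0 : ℝ))), u t ∈ U) {F μ : ℝ} (hF0 : 0 ≤ F) (hμ : 0 ≤ μ)
    (hF : ∀ t, 0 ≤ t → ∀ v ∈ U, ‖f (y t) v‖ ≤ F * Real.exp (μ * t)) {a b : ℝ} (ha : 0 ≤ a)
    (hab : a ≤ b) : ‖y b - y a‖ ≤ (b - a) * (F * Real.exp (μ * b)) := by
  rw [hy.sub_eq ha hab]
  refine (intervalIntegral.norm_integral_le_of_norm_le_const_ae
    (C := F * Real.exp (μ * b)) ?_).trans_eq ?_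
  · filter_upwards [ae_uIoc_of_ae_Ioi huU ha hab] with s hs hsI
    obtain ⟨⟨h1, h2⟩, h3⟩ := hs hsI
    refine (hF s (by linarith) _ h3).trans ?_
    gcongr
  · rw [abs_of_nonneg (by linarith)]; ring

end Trajectories

/-! ### Errors of the Euler iterates and of the discrete cost -/

section CostError

variable {n m : ℕ} {f : E n → E m → E n} {g : E n → E m → ℝ} {U : Set (E m)} {L Lg : ℝ}
  {u : ℝ → E m} {y : ℝ → E n} {y₀ : E n} {v : ℕ → E m} {N : ℕ} {F G D μ κ lam h : ℝ}

/-- The defect of a control sequence `v` with respect to a control `u` on the `j`-th time step, for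
the map `Φ` and along the states `y (j h)`. -/
def stepDefect {F : Type*} [NormedAddCommGroup F] [NormedSpace ℝ F] (Φ : E n → E m → F)
    (y : ℝ → E n) (u : ℝ → E m) (v : ℕ → E m) (h : ℝ) (j : ℕ) : F :=
  (∫ s in (j * h : ℝ)..((j + 1 : ℕ) * h : ℝ), Φ (y (j * h)) (u s)) - h • Φ (y (j * h)) (v j)

lemma exp_mul_step_le (hμ : 0 ≤ μ) (hμh : μ * h ≤ 1) {k : ℕ} {s : ℝ}
    (hs : s ≤ (k + 1 : ℕ) * h) : Real.exp (μ * s) ≤ Real.exp 1 * Real.exp (μ * (k * h)) := by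
  rw [← Real.exp_add]
  refine Real.exp_le_exp.2 ?_
  push_cast at hs
  nlinarith

/-- On a time step, replacing the state by its initial value changes the integral of a Lipschitz map
along the trajectory by `O(h²)`. -/
lemma IsTrajectory.norm_integral_sub_integral_le {F' : Type*} [NormedAddCommGroup F']
    [NormedSpace ℝ F'] {Φ : E n → E m → F'} {K : ℝ} (hy : IsTrajectory f u y₀ y)
    (huU : ∀ᵐ t ∂(volume.restrict (Ioi (0 : ℝ))), u t ∈ U) (hF0 : 0 ≤ F) (hμ : 0 ≤ μ)
    (hh : 0 < h) (hμh : μ * h ≤ 1)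
    (hF : ∀ t, 0 ≤ t → ∀ v ∈ U, ‖f (y t) v‖ ≤ F * Real.exp (μ * t))
    (hΦ : ∀ y y' : E n, ∀ u ∈ U, ‖Φ y u - Φ y' u‖ ≤ K * ‖y - y'‖) (hK : 0 ≤ K) (k : ℕ)
    (hi1 : IntervalIntegrable (fun s => Φ (y s) (u s)) volume (k * h) ((k + 1 : ℕ) * h))
    (hi2 : IntervalIntegrable (fun s => Φ (y (k * h)) (u s)) volume (k * h) ((k + 1 : ℕ) * h)) :
    ‖(∫ s in (k * h : ℝ)..((k + 1 : ℕ) * h : ℝ), Φ (y s) (u s))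
        - ∫ s in (k * h : ℝ)..((k + 1 : ℕ) * h : ℝ), Φ (y (k * h)) (u s)‖
      ≤ h * (K * F * Real.exp 1) * (h * Real.exp (μ * (k * h))) := by
  have ht0 : (0 : ℝ) ≤ k * h := by positivity
  have hab : (k : ℝ) * h ≤ (k + 1 : ℕ) * h := by push_cast; linarith
  rw [← intervalIntegral.integral_sub hi1 hi2]
  refine (intervalIntegral.norm_integral_le_of_norm_le_const_ae
    (C := K * (h * (F * (Real.exp 1 * Real.exp (μ * (k * h)))))) ?_).trans_eq ?_
  · filter_upwards [ae_uIoc_of_ae_Ioi huU ht0 hab] with s hs hsI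
    obtain ⟨⟨h1, h2⟩, h3⟩ := hs hsI
    refine (hΦ _ _ _ h3).trans (mul_le_mul_of_nonneg_left ?_ hK)
    refine (hy.norm_sub_le_mul huU hF0 hμ hF ht0 h1.le).trans ?_
    have : s - k * h ≤ h := by push_cast at h2; linarith
    gcongr
    exact exp_mul_step_le hμ hμh h2
  · push_cast
    rw [show ((k : ℝ) + 1) * h - k * h = h by ring, abs_of_pos hh]
    ring

lemma intervalIntegrable_traj {F' : Type*} [NormedAddCommGroup F'] {Φ : E n → E m → F'} {B : ℝ}
    (hΦ : Continuous fun p : E n × E m => Φ p.1 p.2) (hyc : ContinuousOn y (Ici 0))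
    (hu : AEStronglyMeasurable u (volume.restrict (Ioi 0)))
    (huU : ∀ᵐ t ∂(volume.restrict (Ioi (0 : ℝ))), u t ∈ U) (hB0 : 0 ≤ B) (hμ : 0 ≤ μ)
    (hB : ∀ t, 0 ≤ t → ∀ v ∈ U, ‖Φ (y t) v‖ ≤ B * Real.exp (μ * t)) {a b : ℝ} (ha : 0 ≤ a)
    (hab : a ≤ b) : IntervalIntegrable (fun s => Φ (y s) (u s)) volume a b := by
  refine intervalIntegrable_of_ae_bound (C := B * Real.exp (μ * b))
    (aestronglyMeasurable_comp_traj hΦ hyc hu) ha hab ?_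
  filter_upwards [ae_uIoc_of_ae_Ioi huU ha hab] with s hs hsI
  obtain ⟨⟨h1, h2⟩, h3⟩ := hs hsI
  refine (hB s (by linarith) _ h3).trans ?_
  gcongr

/-- Error of the Euler iterates whose controls approximate `u` in the mean. -/
lemma IsTrajectory.norm_eulerSeq_sub_le (hy : IsTrajectory f u y₀ y)
    (hfc : Continuous fun p : E n × E m => f p.1 p.2)
    (hf : ∀ y y' : E n, ∀ u ∈ U, ‖f y u - f y' u‖ ≤ L * ‖y - y'‖)
    (hu : AEStronglyMeasurable u (volume.restrict (Ioi 0)))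
    (huU : ∀ᵐ t ∂(volume.restrict (Ioi (0 : ℝ))), u t ∈ U) (hF0 : 0 ≤ F) (hL : 0 ≤ L)
    (hμ : L < μ) (hh : 0 < h) (hμh : μ * h ≤ 1)
    (hF : ∀ t, 0 ≤ t → ∀ v ∈ U, ‖f (y t) v‖ ≤ F * Real.exp (μ * t))
    (hv : ∀ k, v k ∈ U) (hD0 : 0 ≤ D)
    (hD : ∀ k ≤ N, ‖∑ j ∈ Finset.range k, stepDefect f y u v h j‖
      ≤ D * h * Real.exp (μ * (k * h))) :
    ∀ k ≤ N, ‖eulerSeq f h v y₀ k - y (k * h)‖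
      ≤ (D + L * F * Real.exp 1 / μ) * h * μ / (μ - L) * Real.exp (μ * (k * h)) := by
  have hμ0 : 0 < μ := by linarith
  -- Three sources of error: Lipschitz feedback of earlier errors, accumulated control defects, and
  -- freezing the state during each step.
  have hrep : ∀ k : ℕ, eulerSeq f h v y₀ k - y (k * h)
      = ∑ j ∈ Finset.range k, h • (f (eulerSeq f h v y₀ j) (v j) - f (y (j * h)) (v j))
        - ∑ j ∈ Finset.range k, stepDefect f y u v h j
        - ∑ j ∈ Finset.range k, ((∫ s in (j * h : ℝ)..((j + 1 : ℕ) * h : ℝ), f (y s) (u s))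
          - ∫ s in (j * h : ℝ)..((j + 1 : ℕ) * h : ℝ), f (y (j * h)) (u s)) := by
    intro k
    induction k with
    | zero =>
      have := (hy.2 0 le_rfl).2
      simp [eulerSeq, this]
    | succ k ih =>
      have hab : (k : ℝ) * h ≤ (k + 1 : ℕ) * h := by push_cast; linarith
      have h1 := hy.sub_eq (a := k * h) (by positivity) hab
      rw [Finset.sum_range_succ, Finset.sum_range_succ, Finset.sum_range_succ, ← h1, eulerSeq,
        stepDefect]
      have h2 : eulerSeq f h v y₀ k + h • f (eulerSeq f h v y₀ k) (v k)
          - y ((k + 1 : ℕ) * h) = (eulerSeq f h v y₀ k - y (k * h))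
            + h • f (eulerSeq f h v y₀ k) (v k) - (y ((k + 1 : ℕ) * h) - y (k * h)) := by abel
      rw [h2, ih]
      module
  refine discrete_gronwall_exp (a := fun k => ‖eulerSeq f h v y₀ k - y (k * h)‖) (by positivity)
    hL hμ hh ?_
  intro k hk
  have hint : ∀ {a b : ℝ}, 0 ≤ a → a ≤ b →
      IntervalIntegrable (fun s => f (y s) (u s)) volume a b := fun ha hab =>
    intervalIntegrable_traj hfc hy.1 hu huU hF0 hμ0.le hF ha hab
  have h1 : ‖∑ j ∈ Finset.range k,
      ((∫ s in (j * h : ℝ)..((j + 1 : ℕ) * h : ℝ), f (y s) (u s))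
        - ∫ s in (j * h : ℝ)..((j + 1 : ℕ) * h : ℝ), f (y (j * h)) (u s))‖
      ≤ h * (L * F * Real.exp 1) * (Real.exp (μ * (k * h)) / μ) := by
    refine (norm_sum_le_of_le _ fun j _ => ?_).trans
      ((Finset.mul_sum _ _ _).symm.le.trans (mul_le_mul_of_nonneg_left (sum_exp_le hμ0 k)
        (by positivity)))
    have hj0 : (0 : ℝ) ≤ j * h := by positivity
    have hab : (j : ℝ) * h ≤ (j + 1 : ℕ) * h := by push_cast; linarith
    refine hy.norm_integral_sub_integral_le huU hF0 hμ0.le hh hμh hF hf hL j (hint hj0 hab) ?_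
    -- The frozen state is treated as a constant path, with growth rate `0`.
    exact intervalIntegrable_traj (B := F * Real.exp (μ * (j * h))) (μ := 0)
      (y := fun _ => y (j * h)) hfc continuousOn_const hu huU (by positivity) le_rfl
      (fun t _ w hw => by simpa using hF _ hj0 w hw) hj0 hab
  have h2 : ‖∑ j ∈ Finset.range k, h • (f (eulerSeq f h v y₀ j) (v j) - f (y (j * h)) (v j))‖
      ≤ h * L * ∑ j ∈ Finset.range k, ‖eulerSeq f h v y₀ j - y (j * h)‖ := by
    rw [Finset.mul_sum]
    refine norm_sum_le_of_le _ fun j _ => ?_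
    rw [norm_smul, Real.norm_eq_abs, abs_of_pos hh, mul_assoc]
    exact mul_le_mul_of_nonneg_left (hf _ _ _ (hv j)) hh.le
  rw [hrep k]
  refine (norm_sub_le _ _).trans ((add_le_add ((norm_sub_le _ _).trans
    (add_le_add h2 (hD k hk))) h1).trans_eq ?_)
  ring

/-- Error of the discrete cost on a finite horizon. -/
lemma IsTrajectory.abs_integral_sub_discCost_le (hy : IsTrajectory f u y₀ y)
    (hfc : Continuous fun p : E n × E m => f p.1 p.2)
    (hgc : Continuous fun p : E n × E m => g p.1 p.2)
    (hf : ∀ y y' : E n, ∀ u ∈ U, ‖f y u - f y' u‖ ≤ L * ‖y - y'‖)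
    (hg : ∀ y y' : E n, ∀ u ∈ U, |g y u - g y' u| ≤ Lg * ‖y - y'‖)
    (hu : AEStronglyMeasurable u (volume.restrict (Ioi 0)))
    (huU : ∀ᵐ t ∂(volume.restrict (Ioi (0 : ℝ))), u t ∈ U) (hF0 : 0 ≤ F) (hG0 : 0 ≤ G)
    (hL : 0 ≤ L) (hLg : 0 ≤ Lg)
    (hμ : L < μ) (hκ : 0 < κ) (hlam : lam = μ + 2 * κ) (hh : 0 < h) (hh1 : lam * h ≤ 1)
    (hF : ∀ t, 0 ≤ t → ∀ v ∈ U, ‖f (y t) v‖ ≤ F * Real.exp (μ * t))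
    (hG : ∀ t, 0 ≤ t → ∀ v ∈ U, ‖g (y t) v‖ ≤ G * Real.exp (μ * t))
    (hv : ∀ k, v k ∈ U) (hD0 : 0 ≤ D)
    (hDf : ∀ k ≤ N, ‖∑ j ∈ Finset.range k, stepDefect f y u v h j‖
      ≤ D * h * Real.exp (μ * (k * h)))
    (hDg : ∀ k ≤ N, ‖∑ j ∈ Finset.range k, stepDefect g y u v h j‖
      ≤ D * h * Real.exp (μ * (k * h))) :
    |(∫ s in (0 : ℝ)..(N * h), g (y s) (u s) * Real.exp (-(lam * s)))
        - discCost f g lam h N v y₀|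
      ≤ ((lam + Real.exp 1 * lam ^ 2 / κ) * G * Real.exp 1 * (2 / κ)
        + Lg * F * Real.exp 1 * (2 / κ) + (D + lam * D * Real.exp 1 * (2 / κ))
        + Lg * ((D + L * F * Real.exp 1 / μ) * μ / (μ - L)) * (2 / κ)) * h := by
  have hμ0 : 0 < μ := by linarith
  have hlam0 : 0 < lam := by linarith
  have hμh : μ * h ≤ 1 := by nlinarith
  have hd : 0 < μ - L := by linarith
  have hβ : 0 ≤ 1 - lam * h := by linarith
  set β := 1 - lam * h with hβdef
  have hβk : ∀ k : ℕ, 0 ≤ β ^ k := fun k => pow_nonneg hβ k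
  have hsum := sum_discount_le hκ hμ0.le (by linarith : μ + κ ≤ lam) hh hh1
  rw [← hβdef] at hsum
  have ht0 : ∀ k : ℕ, (0 : ℝ) ≤ k * h := fun k => by positivity
  have htk : ∀ k : ℕ, (k : ℝ) * h ≤ (k + 1 : ℕ) * h := fun k => by push_cast; linarith
  have hgi : ∀ {a b : ℝ}, 0 ≤ a → a ≤ b →
      IntervalIntegrable (fun s => g (y s) (u s)) volume a b := fun ha hab =>
    intervalIntegrable_traj hgc hy.1 hu huU hG0 hμ0.le hG ha hab
  have hgei : ∀ {a b : ℝ}, 0 ≤ a → a ≤ b →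
      IntervalIntegrable (fun s => g (y s) (u s) * Real.exp (-(lam * s))) volume a b :=
    fun ha hab => (hgi ha hab).mul_continuousOn (by fun_prop)
  have hgi2 : ∀ k : ℕ, IntervalIntegrable (fun s => g (y (k * h)) (u s)) volume (k * h)
      ((k + 1 : ℕ) * h) := fun k =>
    intervalIntegrable_traj (B := G * Real.exp (μ * (k * h))) (μ := 0)
      (y := fun _ => y (k * h)) hgc continuousOn_const hu huU (by positivity) le_rfl
      (fun t _ w hw => by simpa using hG _ (ht0 k) w hw) (ht0 k) (htk k)
  -- From `A` to `B` the discount factor is replaced by its discrete value, applied outside the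
  -- integral. From `B` to `C` the state is frozen. The controls are then replaced by `v k`, and
  -- finally the states by Euler iterates.
  let A : ℕ → ℝ := fun k => ∫ s in (k * h : ℝ)..((k + 1 : ℕ) * h : ℝ),
    g (y s) (u s) * Real.exp (-(lam * s))
  let B : ℕ → ℝ := fun k => ∫ s in (k * h : ℝ)..((k + 1 : ℕ) * h : ℝ), g (y s) (u s)
  let C : ℕ → ℝ := fun k => ∫ s in (k * h : ℝ)..((k + 1 : ℕ) * h : ℝ), g (y (k * h)) (u s)
  have hA : ∫ s in (0 : ℝ)..(N * h), g (y s) (u s) * Real.exp (-(lam * s))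
      = ∑ k ∈ Finset.range N, A k := by
    have := intervalIntegral.sum_integral_adjacent_intervals (n := N) (μ := volume)
      (a := fun k : ℕ => (k : ℝ) * h) (f := fun s => g (y s) (u s) * Real.exp (-(lam * s)))
      (fun k _ => hgei (ht0 k) (htk k))
    simpa [A] using this.symm
  -- the four contributions
  have h1 : |∑ k ∈ Finset.range N, (A k - β ^ k * B k)|
      ≤ (lam + Real.exp 1 * lam ^ 2 / κ) * G * Real.exp 1 * (2 / κ) * h := by
    set c := lam + Real.exp 1 * lam ^ 2 / κ with hc
    have hc0 : 0 ≤ c := by positivity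
    have hterm : ∀ k ∈ Finset.range N, ‖A k - β ^ k * B k‖
        ≤ c * G * Real.exp 1 * h * (h * Real.exp (-(κ * (k * h)))) := by
      intro k _
      have e : A k - β ^ k * B k = ∫ s in (k * h : ℝ)..((k + 1 : ℕ) * h : ℝ),
          g (y s) (u s) * (Real.exp (-(lam * s)) - β ^ k) := by
        simp only [A, B]
        rw [← intervalIntegral.integral_const_mul, ← intervalIntegral.integral_sub
          (hgei (ht0 k) (htk k)) ((hgi (ht0 k) (htk k)).const_mul _)]
        congr 1; ext s; ring
      rw [e]
      refine (intervalIntegral.norm_integral_le_of_norm_le_const_ae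
        (C := G * (Real.exp 1 * Real.exp (μ * (k * h)))
          * (c * h * Real.exp (-((lam - κ) * (k * h))))) ?_).trans_eq ?_
      · filter_upwards [ae_uIoc_of_ae_Ioi huU (ht0 k) (htk k)] with s hs hsI
        obtain ⟨⟨h1, h2⟩, h3⟩ := hs hsI
        rw [norm_mul]
        refine mul_le_mul ((hG s (by linarith [ht0 k]) _ h3).trans ?_)
          (abs_exp_sub_pow_le hlam0 hκ hh hh1 k h1.le h2) (norm_nonneg _) (by positivity)
        gcongr
        exact exp_mul_step_le hμ0.le hμh h2
      · push_cast
        rw [show ((k : ℝ) + 1) * h - k * h = h by ring, abs_of_pos hh]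
        -- The gap `lam - μ = 2 * κ` is split: one `κ` was spent on comparing discount factors, the
        -- other leaves a summable weight.
        have e2 : Real.exp (-(κ * (k * h)))
            = Real.exp (μ * (k * h)) * Real.exp (-((lam - κ) * (k * h))) := by
          rw [← Real.exp_add, hlam]; ring_nf
        rw [e2]; ring
    refine (norm_sum_le_of_le _ hterm).trans ?_
    rw [← Finset.mul_sum]
    refine (mul_le_mul_of_nonneg_left (sum_exp_neg_le hκ hh (by nlinarith) N)
      (by positivity)).trans_eq ?_
    ring
  have h2 : |∑ k ∈ Finset.range N, β ^ k * (B k - C k)|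
      ≤ Lg * F * Real.exp 1 * (2 / κ) * h := by
    have hterm : ∀ k ∈ Finset.range N, ‖β ^ k * (B k - C k)‖
        ≤ h * (Lg * F * Real.exp 1) * (h * (β ^ k * Real.exp (μ * (k * h)))) := by
      intro k _
      have := hy.norm_integral_sub_integral_le (Φ := g) huU hF0 hμ0.le hh hμh hF hg hLg k
        (hgi (ht0 k) (htk k)) (hgi2 k)
      rw [norm_mul, Real.norm_of_nonneg (hβk k)]
      calc β ^ k * ‖B k - C k‖
          ≤ β ^ k * (h * (Lg * F * Real.exp 1) * (h * Real.exp (μ * (k * h)))) := by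
            gcongr
        _ = _ := by ring
    refine (norm_sum_le_of_le _ hterm).trans ?_
    rw [← Finset.mul_sum]
    refine (mul_le_mul_of_nonneg_left (hsum N) (by positivity)).trans_eq ?_
    ring
  have h3 : |∑ k ∈ Finset.range N, β ^ k * (C k - h * g (y (k * h)) (v k))|
      ≤ (D + lam * D * Real.exp 1 * (2 / κ)) * h := by
    have hdef : ∀ k, C k - h * g (y (k * h)) (v k) = stepDefect g y u v h k := fun k => rfl
    simp_rw [hdef]
    rw [abel_sum_discount]
    have hb1 : |β ^ N * ∑ j ∈ Finset.range N, stepDefect g y u v h j| ≤ D * h := by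
      rw [abs_mul, abs_of_nonneg (hβk N)]
      calc β ^ N * |∑ j ∈ Finset.range N, stepDefect g y u v h j|
          ≤ β ^ N * (D * h * Real.exp (μ * (N * h))) :=
            mul_le_mul_of_nonneg_left (hDg N le_rfl) (hβk N)
        _ = D * h * (β ^ N * Real.exp (μ * (N * h))) := by ring
        _ ≤ D * h * 1 := by
            gcongr
            calc β ^ N * Real.exp (μ * (N * h))
                ≤ Real.exp (-(lam * (N * h))) * Real.exp (μ * (N * h)) := by
                  gcongr; exact one_sub_pow_le_exp hh1 N
              _ = Real.exp ((μ - lam) * (N * h)) := by rw [← Real.exp_add]; ring_nf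
              _ ≤ 1 := by
                rw [Real.exp_le_one_iff]
                exact mul_nonpos_of_nonpos_of_nonneg (by linarith) (ht0 N)
        _ = _ := mul_one _
    have hb2 : |(1 - β) * ∑ k ∈ Finset.range N, β ^ k * ∑ j ∈ Finset.range (k + 1),
        stepDefect g y u v h j| ≤ lam * D * Real.exp 1 * (2 / κ) * h := by
      rw [show 1 - β = lam * h by rw [hβdef]; ring, abs_mul, abs_of_nonneg (by positivity)]
      have hterm : ∀ k ∈ Finset.range N, ‖β ^ k * ∑ j ∈ Finset.range (k + 1),
          stepDefect g y u v h j‖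
          ≤ D * Real.exp 1 * (h * (β ^ k * Real.exp (μ * (k * h)))) := by
        intro k hk
        rw [norm_mul, Real.norm_of_nonneg (hβk k)]
        calc β ^ k * ‖∑ j ∈ Finset.range (k + 1), stepDefect g y u v h j‖
            ≤ β ^ k * (D * h * (Real.exp 1 * Real.exp (μ * (k * h)))) := by
              refine mul_le_mul_of_nonneg_left ?_ (hβk k)
              refine (hDg (k + 1) (by simpa using hk)).trans ?_
              gcongr
              exact exp_mul_step_le hμ0.le hμh le_rfl
          _ = _ := by ring
      have hs := norm_sum_le_of_le _ hterm
      rw [← Finset.mul_sum] at hs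
      calc _ ≤ lam * h * (D * Real.exp 1 * (2 / κ)) := by
            refine mul_le_mul_of_nonneg_left (hs.trans ?_) (by positivity)
            exact mul_le_mul_of_nonneg_left (hsum N) (by positivity)
        _ = _ := by ring
    refine (abs_add_le _ _).trans ((add_le_add hb1 hb2).trans_eq ?_)
    ring
  have h4 : |∑ k ∈ Finset.range N, β ^ k * (h * g (y (k * h)) (v k)
        - h * g (eulerSeq f h v y₀ k) (v k))|
      ≤ Lg * ((D + L * F * Real.exp 1 / μ) * μ / (μ - L)) * (2 / κ) * h := by
    have heul := hy.norm_eulerSeq_sub_le hfc hf hu huU hF0 hL hμ hh hμh hF hv hD0 hDf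
    have hterm : ∀ k ∈ Finset.range N, ‖β ^ k * (h * g (y (k * h)) (v k)
        - h * g (eulerSeq f h v y₀ k) (v k))‖
        ≤ Lg * ((D + L * F * Real.exp 1 / μ) * h * μ / (μ - L))
          * (h * (β ^ k * Real.exp (μ * (k * h)))) := by
      intro k hk
      have hk' : k ≤ N := by have := Finset.mem_range.1 hk; omega
      rw [norm_mul, Real.norm_of_nonneg (hβk k), ← mul_sub, norm_mul, Real.norm_of_nonneg hh.le]
      calc β ^ k * (h * ‖g (y (k * h)) (v k) - g (eulerSeq f h v y₀ k) (v k)‖)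
          ≤ β ^ k * (h * (Lg * ((D + L * F * Real.exp 1 / μ) * h * μ / (μ - L)
              * Real.exp (μ * (k * h))))) := by
            refine mul_le_mul_of_nonneg_left (mul_le_mul_of_nonneg_left
              ((hg _ _ _ (hv k)).trans (mul_le_mul_of_nonneg_left ?_ hLg)) hh.le) (hβk k)
            rw [norm_sub_rev]; exact heul k hk'
        _ = _ := by ring
    refine (norm_sum_le_of_le _ hterm).trans ?_
    rw [← Finset.mul_sum]
    refine (mul_le_mul_of_nonneg_left (hsum N) (by positivity)).trans_eq ?_
    ring
  have hsplit : (∑ k ∈ Finset.range N, A k) - discCost f g lam h N v y₀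
      = ∑ k ∈ Finset.range N, (A k - β ^ k * B k) + ∑ k ∈ Finset.range N, β ^ k * (B k - C k)
        + ∑ k ∈ Finset.range N, β ^ k * (C k - h * g (y (k * h)) (v k))
        + ∑ k ∈ Finset.range N, β ^ k * (h * g (y (k * h)) (v k)
          - h * g (eulerSeq f h v y₀ k) (v k)) := by
    rw [discCost, ← Finset.sum_sub_distrib, ← Finset.sum_add_distrib, ← Finset.sum_add_distrib,
      ← Finset.sum_add_distrib]
    refine Finset.sum_congr rfl fun k _ => ?_
    ring
  rw [hA, hsplit]
  refine (abs_add_le _ _).trans ((add_le_add ((abs_add_le _ _).trans (add_le_add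
    ((abs_add_le _ _).trans (add_le_add h1 h2)) h3)) h4).trans_eq ?_)
  ring

/-- The tail of the cost functional. -/
lemma IsTrajectory.abs_cost_sub_integral_le (hy : IsTrajectory f u y₀ y)
    (hgc : Continuous fun p : E n × E m => g p.1 p.2)
    (hu : AEStronglyMeasurable u (volume.restrict (Ioi 0)))
    (huU : ∀ᵐ t ∂(volume.restrict (Ioi (0 : ℝ))), u t ∈ U)
    (hμ : μ < lam) (hG : ∀ t, 0 ≤ t → ∀ v ∈ U, ‖g (y t) v‖ ≤ G * Real.exp (μ * t))
    {T : ℝ} (hT : 0 ≤ T) :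
    |cost g lam y u - ∫ s in (0 : ℝ)..T, g (y s) (u s) * Real.exp (-(lam * s))|
      ≤ G / (lam - μ) * Real.exp (-((lam - μ) * T)) := by
  have hd : 0 < lam - μ := by linarith
  have hbound : ∀ᵐ s ∂(volume.restrict (Ioi (0 : ℝ))),
      ‖g (y s) (u s) * Real.exp (-(lam * s))‖ ≤ G * Real.exp (-(lam - μ) * s) := by
    filter_upwards [huU, ae_restrict_mem measurableSet_Ioi] with s hs hs0
    rw [norm_mul, Real.norm_of_nonneg (Real.exp_pos _).le]
    calc ‖g (y s) (u s)‖ * Real.exp (-(lam * s))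
        ≤ G * Real.exp (μ * s) * Real.exp (-(lam * s)) := by
          gcongr; exact hG s (le_of_lt hs0) _ hs
      _ = _ := by rw [mul_assoc, ← Real.exp_add]; ring_nf
  have hexp : IntegrableOn (fun s => G * Real.exp (-(lam - μ) * s)) (Ioi 0) :=
    (exp_neg_integrableOn_Ioi 0 hd).const_mul G
  have hint : IntegrableOn (fun s => g (y s) (u s) * Real.exp (-(lam * s))) (Ioi 0) := by
    refine Integrable.mono' hexp ?_ hbound
    exact (aestronglyMeasurable_comp_traj hgc hy.1 hu).mul
      (Continuous.aestronglyMeasurable (by fun_prop))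
  have hsub : Ioi T ⊆ Ioi (0 : ℝ) := Ioi_subset_Ioi hT
  have e : cost g lam y u - ∫ s in (0 : ℝ)..T, g (y s) (u s) * Real.exp (-(lam * s))
      = ∫ s in Ioi T, g (y s) (u s) * Real.exp (-(lam * s)) := by
    rw [cost, intervalIntegral.integral_of_le hT, ← Ioc_union_Ioi_eq_Ioi hT,
      setIntegral_union (Set.Ioc_disjoint_Ioi le_rfl) measurableSet_Ioi
        (hint.mono_set Ioc_subset_Ioi_self) (hint.mono_set hsub)]
    ring
  rw [e]
  refine (norm_integral_le_of_norm_le (hexp.mono_set hsub)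
    (ae_restrict_of_ae_restrict_of_subset hsub hbound)).trans_eq ?_
  rw [integral_const_mul, integral_exp_mul_Ioi (by linarith)]
  rw [neg_div_neg_eq, neg_mul]
  ring

end CostError

/-! ### Existence of Carathéodory trajectories -/

section Existence

variable {n m : ℕ} {f : E n → E m → E n} {U : Set (E m)} {L : ℝ} {u : ℝ → E m} {y₀ : E n}

lemma intervalIntegrable_of_exp_bound {F' : Type*} [NormedAddCommGroup F'] {ψ : ℝ → F'} {C μ : ℝ}
    (hm : AEStronglyMeasurable ψ volume) (hb : ∀ᵐ s, ‖ψ s‖ ≤ C * Real.exp (μ * s)) (a b : ℝ) :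
    IntervalIntegrable ψ volume a b := by
  have h : IntervalIntegrable (fun s => C * Real.exp (μ * s)) volume a b :=
    Continuous.intervalIntegrable (by fun_prop) a b
  exact h.mono_fun hm.restrict (ae_restrict_of_ae (hb.mono fun s hs => hs.trans (le_abs_self _)))

/-- Integrating growth `exp (μ * s)` gains a factor `1 / μ`. Used both to see that the Picard map
has bounded values and that it contracts. -/
lemma norm_exp_smul_integral_le {ψ : ℝ → E n} {C μ : ℝ} (hμ : 0 < μ) (hC : 0 ≤ C)
    (h0 : ∀ s ≤ 0, ψ s = 0) (hb : ∀ᵐ s, ‖ψ s‖ ≤ C * Real.exp (μ * s)) (t : ℝ) :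
    ‖Real.exp (-(μ * t)) • ∫ s in (0 : ℝ)..t, ψ s‖ ≤ C / μ := by
  rcases le_total t 0 with ht | ht
  · have : ∫ s in (0 : ℝ)..t, ψ s = 0 := by
      rw [intervalIntegral.integral_congr (g := fun _ => 0) fun s hs => ?_]
      · simp
      · rw [uIcc_of_ge ht] at hs; exact h0 s hs.2
    rw [this, smul_zero, norm_zero]; positivity
  · have h1 : ‖∫ s in (0 : ℝ)..t, ψ s‖ ≤ ∫ s in (0 : ℝ)..t, C * Real.exp (μ * s) :=
      intervalIntegral.norm_integral_le_of_norm_le ht (hb.mono fun s hs _ => hs)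
        (Continuous.intervalIntegrable (by fun_prop) _ _)
    rw [intervalIntegral.integral_const_mul, integral_exp_mul_le hμ] at h1
    rw [norm_smul, Real.norm_of_nonneg (Real.exp_pos _).le]
    have e : Real.exp (-(μ * t)) * Real.exp (μ * t) = 1 := by rw [← Real.exp_add]; simp
    calc Real.exp (-(μ * t)) * ‖∫ s in (0 : ℝ)..t, ψ s‖
        ≤ Real.exp (-(μ * t)) * (C * ((Real.exp (μ * t) - 1) / μ)) := by gcongr
      _ = C / μ * (Real.exp (-(μ * t)) * Real.exp (μ * t)) - C / μ * Real.exp (-(μ * t)) := by ring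
      _ ≤ C / μ := by
        rw [e]
        have : 0 ≤ C / μ * Real.exp (-(μ * t)) := by positivity
        linarith

/-- Global existence of Carathéodory trajectories, by the contraction principle in an
exponentially weighted space. -/
theorem exists_isTrajectory (hfc : Continuous fun p : E n × E m => f p.1 p.2)
    (hf : ∀ y y' : E n, ∀ u ∈ U, ‖f y u - f y' u‖ ≤ L * ‖y - y'‖) (hL : 0 ≤ L)
    (hu : AEStronglyMeasurable u (volume.restrict (Ioi 0)))
    (huU : ∀ᵐ t ∂(volume.restrict (Ioi (0 : ℝ))), u t ∈ U) {F : ℝ} (hF0 : 0 ≤ F)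
    (hF : ∀ v ∈ U, ‖f y₀ v‖ ≤ F) : ∃ y, IsTrajectory f u y₀ y := by
  -- Any weight above `L` gives a contraction constant `L / μ < 1`, globally in time.
  set μ := L + 1 with hμdef
  have hμ : 0 < μ := by positivity
  let X := BoundedContinuousFunction ℝ (E n)
  let Y : X → ℝ → E n := fun x s => y₀ + Real.exp (μ * s) • x s
  have hYc : ∀ x : X, Continuous (Y x) := fun x => by
    have := x.continuous
    fun_prop
  -- The control is constrained only on `(0, ∞)`; extension of the integrand by zero allows bounded
  -- continuous functions on all of `ℝ` as the underlying complete space.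
  let ψ : X → ℝ → E n := fun x => (Ioi (0 : ℝ)).indicator fun s => f (Y x s) (u s)
  have hψm : ∀ x, AEStronglyMeasurable (ψ x) volume := fun x =>
    (aestronglyMeasurable_indicator_iff measurableSet_Ioi).2
      (aestronglyMeasurable_comp_traj hfc (hYc x).continuousOn hu)
  have hψ0 : ∀ x, ∀ s ≤ 0, ψ x s = 0 := fun x s hs => indicator_of_notMem (by simpa using hs) _
  rw [ae_restrict_iff' measurableSet_Ioi] at huU
  have hψb : ∀ x, ∀ᵐ s, ‖ψ x s‖ ≤ (F + L * ‖x‖) * Real.exp (μ * s) := by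
    intro x
    filter_upwards [huU] with s hs
    by_cases hs0 : s ∈ Ioi (0 : ℝ)
    · simp only [ψ, indicator_of_mem hs0]
      refine norm_le_of_growth hf hL hF0 hF hμ.le (le_of_lt hs0) ?_ _ (hs hs0)
      simp only [Y, add_sub_cancel_left, norm_smul, Real.norm_of_nonneg (Real.exp_pos _).le]
      rw [mul_comm]
      gcongr
      exact x.norm_coe_le_norm s
    · simp only [ψ, indicator_of_notMem hs0, norm_zero]; positivity
  have hψd : ∀ x x', ∀ᵐ s, ‖ψ x s - ψ x' s‖ ≤ (L * dist x x') * Real.exp (μ * s) := by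
    intro x x'
    filter_upwards [huU] with s hs
    by_cases hs0 : s ∈ Ioi (0 : ℝ)
    · simp only [ψ, indicator_of_mem hs0]
      refine (hf _ _ _ (hs hs0)).trans ?_
      simp only [Y, add_sub_add_left_eq_sub, ← smul_sub, norm_smul,
        Real.norm_of_nonneg (Real.exp_pos _).le, ← dist_eq_norm]
      rw [mul_comm (Real.exp _), ← mul_assoc]
      gcongr
      exact BoundedContinuousFunction.dist_coe_le_dist s
    · simp only [ψ, indicator_of_notMem hs0, sub_self, norm_zero]; positivity
  have hψi : ∀ x a b, IntervalIntegrable (ψ x) volume a b := fun x =>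
    intervalIntegrable_of_exp_bound (hψm x) (hψb x)
  let T : X → X := fun x => BoundedContinuousFunction.ofNormedAddCommGroup
    (fun t => Real.exp (-(μ * t)) • ∫ s in (0 : ℝ)..t, ψ x s)
    ((by fun_prop : Continuous fun t : ℝ => Real.exp (-(μ * t))).smul
      (intervalIntegral.continuous_primitive (hψi x) 0))
    ((F + L * ‖x‖) / μ)
    (norm_exp_smul_integral_le hμ (by positivity) (hψ0 x) (hψb x))
  have hT : ContractingWith (L / μ).toNNReal T := by
    constructor
    · rw [Real.toNNReal_lt_one, div_lt_one hμ, hμdef]; linarith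
    · refine LipschitzWith.of_dist_le_mul fun x x' => ?_
      have hK : 0 ≤ L / μ * dist x x' := by positivity
      rw [Real.coe_toNNReal _ (by positivity)]
      refine (BoundedContinuousFunction.dist_le hK).2 fun t => ?_
      have e : T x t - T x' t
          = Real.exp (-(μ * t)) • ∫ s in (0 : ℝ)..t, (ψ x s - ψ x' s) := by
        rw [intervalIntegral.integral_sub (hψi x _ _) (hψi x' _ _), smul_sub]; rfl
      rw [dist_eq_norm, e]
      refine (norm_exp_smul_integral_le hμ (by positivity) (fun s hs => ?_) (hψd x x') t).trans_eq
        (by ring)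
      rw [hψ0 x s hs, hψ0 x' s hs, sub_self]
  obtain ⟨x, hx⟩ : ∃ x, T x = x := ⟨_, hT.fixedPoint_isFixedPt⟩
  have hYint : ∀ t, Y x t = y₀ + ∫ s in (0 : ℝ)..t, ψ x s := by
    intro t
    have h1 : x t = Real.exp (-(μ * t)) • ∫ s in (0 : ℝ)..t, ψ x s := by
      conv_lhs => rw [← hx]
      rfl
    simp only [Y]
    rw [h1, smul_smul, ← Real.exp_add]
    simp
  refine ⟨Y x, (hYc x).continuousOn, fun t ht => ?_⟩
  have hcongr : EqOn (ψ x) (fun s => f (Y x s) (u s)) (uIoc 0 t) := fun s hs => by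
    rw [uIoc_of_le ht] at hs
    exact indicator_of_mem (show s ∈ Ioi (0 : ℝ) from hs.1) _
  refine ⟨(hψi x 0 t).congr hcongr, ?_⟩
  rw [hYint t, intervalIntegral.integral_congr_ae (ae_of_all _ hcongr)]

end Existence

/-! ### Passing between controls and control sequences -/

section Controls

variable {n m : ℕ} {f : E n → E m → E n} {g : E n → E m → ℝ} {U : Set (E m)} {L Lg : ℝ}
  {u : ℝ → E m} {y : ℝ → E n} {y₀ : E n} {F G μ κ lam h : ℝ}

/-- Since controls are square integrable on an unbounded interval, `0` is a feasible value. -/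
lemma zero_mem_of_admissibleControls_nonempty (hUc : IsClosed U)
    (hU : (admissibleControls U).Nonempty) : (0 : E m) ∈ U := by
  by_contra h0
  obtain ⟨u, hu, huU⟩ := hU
  -- If a ball around `0` misses `U`, every admissible control has norm at least `ε` almost
  -- everywhere on a half-line of infinite measure, against Chebyshev's inequality in `L²`.
  obtain ⟨ε, hε, hball⟩ := Metric.isOpen_iff.1 hUc.isOpen_compl 0 h0
  lift ε to NNReal using hε.le
  have hlt := hu.meas_ge_lt_top (by norm_num) (by norm_num) (ε := ε)
    (fun h => hε.ne' (congrArg NNReal.toReal h))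
  have hae : ∀ᵐ t ∂(volume.restrict (Ioi (0 : ℝ))), ε ≤ ‖u t‖₊ := by
    filter_upwards [huU] with t ht
    by_contra hlt'
    refine hball (a := u t) ?_ ht
    rw [not_le, ← NNReal.coe_lt_coe] at hlt'
    simpa using hlt'
  have huniv : volume.restrict (Ioi (0 : ℝ)) {x | ε ≤ ‖u x‖₊}
      = volume.restrict (Ioi (0 : ℝ)) univ := measure_congr (eventuallyEq_univ.2 hae)
  rw [huniv] at hlt
  simp at hlt

/-- Any control is approximated, in the mean along its trajectory and uniformly in time, by a
control sequence. -/
lemma IsTrajectory.exists_stepDefect_le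
    (hfc : Continuous fun p : E n × E m => f p.1 p.2)
    (hgc : Continuous fun p : E n × E m => g p.1 p.2)
    (hu : AEStronglyMeasurable u (volume.restrict (Ioi 0)))
    (huU : ∀ᵐ t ∂(volume.restrict (Ioi (0 : ℝ))), u t ∈ U) (hF0 : 0 ≤ F) (hG0 : 0 ≤ G)
    (hμ : 0 ≤ μ) (hh : 0 < h)
    (hF : ∀ t, 0 ≤ t → ∀ v ∈ U, ‖f (y t) v‖ ≤ F * Real.exp (μ * t))
    (hG : ∀ t, 0 ≤ t → ∀ v ∈ U, ‖g (y t) v‖ ≤ G * Real.exp (μ * t)) (N : ℕ) :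
    ∃ v : ℕ → E m, (∀ k, v k ∈ U) ∧ ∀ k ≤ N,
      ‖∑ j ∈ Finset.range k, stepDefect f y u v h j‖
        ≤ (2 * (n + 1) * (F + G) + 1) * h * Real.exp (μ * (k * h)) ∧
      ‖∑ j ∈ Finset.range k, stepDefect g y u v h j‖
        ≤ (2 * (n + 1) * (F + G) + 1) * h * Real.exp (μ * (k * h)) := by
  have ht0 : ∀ k : ℕ, (0 : ℝ) ≤ k * h := fun k => by positivity
  have htk : ∀ k : ℕ, (k : ℝ) * h ≤ (k + 1 : ℕ) * h := fun k => by push_cast; linarith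
  -- Dynamics and running cost are balanced jointly, in dimension `n + 1`, so that one control
  -- sequence serves both.
  let S : ℕ → Set (E n × ℝ) := fun k => (fun w => (f (y (k * h)) w, g (y (k * h)) w)) '' U
  let s : ℕ → ℝ := fun k => (F + G) * Real.exp (μ * (k * h))
  have hmono : Monotone s := fun a b hab => by
    simp only [s]
    gcongr
  have hs : ∀ k, ∀ p ∈ S k, ‖p‖ ≤ s k := by
    rintro k _ ⟨w, hw, rfl⟩
    have h1 := hF _ (ht0 k) w hw
    have h2 := hG _ (ht0 k) w hw
    have h3 : 0 ≤ F * Real.exp (μ * (k * h)) := by positivity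
    have h4 : 0 ≤ G * Real.exp (μ * (k * h)) := by positivity
    simp only [s, Prod.norm_def, add_mul]
    exact max_le (by linarith) (by linarith)
  have hif : ∀ k : ℕ, IntervalIntegrable (fun r => f (y (k * h)) (u r)) volume (k * h)
      ((k + 1 : ℕ) * h) := fun k =>
    intervalIntegrable_traj (B := F * Real.exp (μ * (k * h))) (μ := 0)
      (y := fun _ => y (k * h)) hfc continuousOn_const hu huU (by positivity) le_rfl
      (fun t _ w hw => by simpa using hF _ (ht0 k) w hw) (ht0 k) (htk k)
  have hig : ∀ k : ℕ, IntervalIntegrable (fun r => g (y (k * h)) (u r)) volume (k * h)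
      ((k + 1 : ℕ) * h) := fun k =>
    intervalIntegrable_traj (B := G * Real.exp (μ * (k * h))) (μ := 0)
      (y := fun _ => y (k * h)) hgc continuousOn_const hu huU (by positivity) le_rfl
      (fun t _ w hw => by simpa using hG _ (ht0 k) w hw) (ht0 k) (htk k)
  let x : ℕ → E n × ℝ := fun k =>
    h⁻¹ • (∫ r in (k * h : ℝ)..((k + 1 : ℕ) * h : ℝ), f (y (k * h)) (u r),
      ∫ r in (k * h : ℝ)..((k + 1 : ℕ) * h : ℝ), g (y (k * h)) (u r))
  have hx : ∀ k, x k ∈ closure (convexHull ℝ (S k)) := by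
    intro k
    have hvol : volume (Ioc (k * h : ℝ) ((k + 1 : ℕ) * h)) = ENNReal.ofReal h := by
      rw [Real.volume_Ioc]; congr 1; push_cast; ring
    have h1 := (convex_convexHull ℝ (S k)).set_average_mem_closure (μ := volume)
      (t := Ioc (k * h : ℝ) ((k + 1 : ℕ) * h))
      (f := fun r => (f (y (k * h)) (u r), g (y (k * h)) (u r)))
      (by rw [hvol]; simpa using hh) (by rw [hvol]; simp) ?_
      ((((intervalIntegrable_iff_integrableOn_Ioc_of_le (htk k)).1 (hif k)).prodMk
        ((intervalIntegrable_iff_integrableOn_Ioc_of_le (htk k)).1 (hig k))))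
    · rw [setAverage_eq, measureReal_def, hvol, ENNReal.toReal_ofReal hh.le, integral_pair
        ((intervalIntegrable_iff_integrableOn_Ioc_of_le (htk k)).1 (hif k))
        ((intervalIntegrable_iff_integrableOn_Ioc_of_le (htk k)).1 (hig k)),
        ← intervalIntegral.integral_of_le (htk k), ← intervalIntegral.integral_of_le (htk k)] at h1
      exact h1
    · have := ae_uIoc_of_ae_Ioi huU (ht0 k) (htk k)
      rw [uIoc_of_le (htk k)] at this
      rw [ae_restrict_iff' measurableSet_Ioc]
      filter_upwards [this] with r hr hrI
      exact subset_convexHull ℝ _ ⟨u r, (hr hrI).2, rfl⟩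
  obtain ⟨p, hpS, hp⟩ := exists_mem_prefix_sum_le_of_mem_closure S s hmono hs x hx N
  choose v hvU hvp using hpS
  have hrank : Module.finrank ℝ (E n × ℝ) = n + 1 := by simp
  have hdef : ∀ j, (stepDefect f y u v h j, stepDefect g y u v h j) = -(h • (p j - x j)) := by
    intro j
    rw [← hvp j]
    simp only [x, stepDefect, smul_sub, smul_smul, mul_inv_cancel₀ hh.ne', one_smul]
    ext <;> simp
  refine ⟨v, hvU, fun k hk => ?_⟩
  have hpair : ‖((∑ j ∈ Finset.range k, stepDefect f y u v h j,
      ∑ j ∈ Finset.range k, stepDefect g y u v h j) : E n × ℝ)‖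
      ≤ (2 * (n + 1) * (F + G) + 1) * h * Real.exp (μ * (k * h)) := by
    have e : ((∑ j ∈ Finset.range k, stepDefect f y u v h j,
        ∑ j ∈ Finset.range k, stepDefect g y u v h j) : E n × ℝ)
        = -(h • ∑ j ∈ Finset.range k, (p j - x j)) := by
      rw [prod_mk_sum, Finset.smul_sum, ← Finset.sum_neg_distrib]
      exact Finset.sum_congr rfl fun j _ => hdef j
    rw [e, norm_neg, norm_smul, Real.norm_of_nonneg hh.le]
    have h1 := hp k hk
    rw [hrank] at h1
    have h2 : 1 ≤ Real.exp (μ * (k * h)) := Real.one_le_exp (mul_nonneg hμ (ht0 k))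
    push_cast at h1
    calc h * ‖∑ j ∈ Finset.range k, (p j - x j)‖
        ≤ h * (2 * (n + 1) * ((F + G) * Real.exp (μ * (k * h))) + Real.exp (μ * (k * h))) := by
          gcongr
          exact h1.trans (by gcongr)
      _ = _ := by ring
  exact ⟨(norm_fst_le _).trans hpair, (norm_snd_le _).trans hpair⟩

/-- The control which follows a control sequence for `N` steps and then vanishes. -/
def stepControl (v : ℕ → E m) (h : ℝ) (N : ℕ) : ℝ → E m :=
  (Iio (N * h : ℝ)).indicator fun t => v ⌊t / h⌋₊

lemma stepControl_mem {v : ℕ → E m} (hv : ∀ k, v k ∈ U) (h0 : (0 : E m) ∈ U) (N : ℕ) (t : ℝ) :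
    stepControl v h N t ∈ U := by
  rw [stepControl]
  by_cases ht : t ∈ Iio (N * h : ℝ)
  · rw [indicator_of_mem ht]; exact hv _
  · rwa [indicator_of_notMem ht]

/-- Vanishing after time `N * h` is what makes the bounded control square integrable; `0 ∈ U` keeps
it feasible. -/
lemma stepControl_mem_admissibleControls (hUb : Bornology.IsBounded U) {v : ℕ → E m}
    (hv : ∀ k, v k ∈ U) (h0 : (0 : E m) ∈ U) (N : ℕ) :
    stepControl v h N ∈ admissibleControls U := by
  refine ⟨?_, ae_of_all _ fun t => stepControl_mem hv h0 N t⟩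
  obtain ⟨C, hC⟩ := hUb.exists_norm_le
  have hmeas : Measurable fun t : ℝ => v ⌊t / h⌋₊ :=
    (measurable_from_nat (f := v)).comp (Nat.measurable_floor.comp (measurable_id.div_const h))
  rw [stepControl, memLp_indicator_iff_restrict measurableSet_Iio,
    Measure.restrict_restrict measurableSet_Iio]
  have : IsFiniteMeasure (volume.restrict (Iio (N * h : ℝ) ∩ Ioi 0)) := by
    refine ⟨?_⟩
    rw [Measure.restrict_apply_univ, inter_comm, Ioi_inter_Iio]
    exact measure_Ioo_lt_top
  exact MemLp.of_bound hmeas.aestronglyMeasurable C (ae_of_all _ fun t => hC _ (hv _))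

lemma stepDefect_stepControl {F' : Type*} [NormedAddCommGroup F'] [NormedSpace ℝ F']
    [CompleteSpace F'] (Φ : E n → E m → F') (y : ℝ → E n) (v : ℕ → E m) (hh : 0 < h) {N j : ℕ} (hj : j < N) :
    stepDefect Φ y (stepControl v h N) v h j = 0 := by
  have htk : (j : ℝ) * h ≤ (j + 1 : ℕ) * h := by push_cast; linarith
  have e : ∫ s in (j * h : ℝ)..((j + 1 : ℕ) * h : ℝ), Φ (y (j * h)) (stepControl v h N s)
      = ∫ s in (j * h : ℝ)..((j + 1 : ℕ) * h : ℝ), Φ (y (j * h)) (v j) := by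
    refine intervalIntegral.integral_congr_ae ?_
    -- At the right endpoint the floor is already `j + 1`; this single point is discarded as a null
    -- set.
    filter_upwards [Measure.ae_ne volume (((j + 1 : ℕ) * h : ℝ))] with s hs hsI
    rw [uIoc_of_le htk] at hsI
    have hlt : s < (j + 1 : ℕ) * h := lt_of_le_of_ne hsI.2 hs
    have hsN : s ∈ Iio (N * h : ℝ) := by
      refine hlt.trans_le ?_
      have : ((j + 1 : ℕ) : ℝ) ≤ N := by exact_mod_cast hj
      gcongr
    have hfl : ⌊s / h⌋₊ = j := by
      have hs0 : 0 ≤ s := le_trans (by positivity) hsI.1.le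
      rw [Nat.floor_eq_iff (by positivity)]
      constructor
      · rw [le_div_iff₀ hh]; exact hsI.1.le
      · rw [div_lt_iff₀ hh]; push_cast at hlt; exact hlt
    rw [stepControl, indicator_of_mem hsN, hfl]
  rw [stepDefect, e, intervalIntegral.integral_const]
  push_cast
  rw [show ((j : ℝ) + 1) * h - j * h = h by ring, sub_self]

/-- Continuous and discrete controls give the same costs up to `O(h)`, uniformly in the initial
state as long as `f` and `g` are bounded there. -/
theorem exists_cost_error_bound (hfc : Continuous fun p : E n × E m => f p.1 p.2)
    (hgc : Continuous fun p : E n × E m => g p.1 p.2)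
    (hf : ∀ y y' : E n, ∀ u ∈ U, ‖f y u - f y' u‖ ≤ L * ‖y - y'‖)
    (hg : ∀ y y' : E n, ∀ u ∈ U, |g y u - g y' u| ≤ Lg * ‖y - y'‖)
    (hL : 0 ≤ L) (hLg : 0 ≤ Lg) (hlam : L < lam) (hUb : Bornology.IsBounded U)
    (h0 : (0 : E m) ∈ U) (hF0 : 0 ≤ F) (hG0 : 0 ≤ G) :
    ∃ C κ : ℝ, 0 ≤ C ∧ 0 < κ ∧ ∀ h : ℝ, 0 < h → lam * h ≤ 1 → ∀ y₀ : E n,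
      (∀ v ∈ U, ‖f y₀ v‖ ≤ F) → (∀ v ∈ U, ‖g y₀ v‖ ≤ G) →
      (∀ u ∈ admissibleControls U, ∀ y, IsTrajectory f u y₀ y → ∀ N : ℕ,
        ∃ v : ℕ → E m, (∀ k, v k ∈ U) ∧ |cost g lam y u - discCost f g lam h N v y₀|
          ≤ C * h + C * Real.exp (-(κ * (N * h)))) ∧
      (∀ v : ℕ → E m, (∀ k, v k ∈ U) → ∀ N : ℕ,
        ∃ u ∈ admissibleControls U, ∃ y, IsTrajectory f u y₀ y ∧
          |cost g lam y u - discCost f g lam h N v y₀|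
            ≤ C * h + C * Real.exp (-(κ * (N * h)))) := by
  -- Above `L`, the rate `μ` dominates the growth of trajectories and Euler errors; below `lam`, it
  -- is beaten by the discount.
  obtain ⟨μ, hLμ, hμlam⟩ := exists_between hlam
  have hd : 0 < μ - L := by linarith
  have hd' : 0 < lam - μ := by linarith
  have hμ : 0 < μ := by linarith
  set κ := (lam - μ) / 2 with hκdef
  have hκ : 0 < κ := by positivity
  set F₁ := F + L * (F / (μ - L)) with hF₁
  set G₁ := G + Lg * (F / (μ - L)) with hG₁
  have hF₁0 : 0 ≤ F₁ := by positivity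
  have hG₁0 : 0 ≤ G₁ := by positivity
  set D := 2 * (n + 1) * (F₁ + G₁) + 1 with hD
  have hD0 : 0 ≤ D := by positivity
  set C₁ := (lam + Real.exp 1 * lam ^ 2 / κ) * G₁ * Real.exp 1 * (2 / κ)
        + Lg * F₁ * Real.exp 1 * (2 / κ) + (D + lam * D * Real.exp 1 * (2 / κ))
        + Lg * ((D + L * F₁ * Real.exp 1 / μ) * μ / (μ - L)) * (2 / κ) with hC₁
  have hlam0 : 0 < lam := by linarith
  have hC₁0 : 0 ≤ C₁ := by positivity
  set C₂ := G₁ / (lam - μ) with hC₂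
  have hC₂0 : 0 ≤ C₂ := by positivity
  -- The rate returned is that of the tail of the cost integral, twice the local `κ`.
  refine ⟨C₁ + C₂, lam - μ, by positivity, hd', fun h hh hh1 y₀ hfy hgy => ?_⟩
  have key : ∀ u ∈ admissibleControls U, ∀ y, IsTrajectory f u y₀ y → ∀ (N : ℕ) (v : ℕ → E m),
      (∀ k, v k ∈ U) →
      (∀ k ≤ N, ‖∑ j ∈ Finset.range k, stepDefect f y u v h j‖
        ≤ D * h * Real.exp (μ * (k * h)) ∧
        ‖∑ j ∈ Finset.range k, stepDefect g y u v h j‖ ≤ D * h * Real.exp (μ * (k * h))) →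
      |cost g lam y u - discCost f g lam h N v y₀|
        ≤ (C₁ + C₂) * h + (C₁ + C₂) * Real.exp (-((lam - μ) * (N * h))) := by
    intro u hu y hy N v hv hdef
    have hgrow := fun t ht => hy.norm_sub_initial_le hf hu.2 hF0 hfy hL hLμ (T := t) ht
    have hF := fun t ht => norm_le_of_growth hf hL hF0 hfy hμ.le ht (hgrow t ht)
    have hG := fun t ht => norm_le_of_growth hg hLg hG0 hgy hμ.le ht (hgrow t ht)
    have h1 := hy.abs_integral_sub_discCost_le (κ := κ) (N := N) hfc hgc hf hg
      hu.1.aestronglyMeasurable hu.2 hF₁0 hG₁0 hL hLg hLμ hκ (by rw [hκdef]; ring) hh hh1 hF hG hv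
      hD0 (fun k hk => (hdef k hk).1) (fun k hk => (hdef k hk).2)
    have h2 := hy.abs_cost_sub_integral_le hgc hu.1.aestronglyMeasurable hu.2 hμlam hG
      (T := N * h) (by positivity)
    rw [← hC₁] at h1
    have h3 : 0 ≤ C₂ * h := by positivity
    have h4 : 0 ≤ C₁ * Real.exp (-((lam - μ) * (N * h))) := by positivity
    have h5 := abs_sub_le (cost g lam y u)
      (∫ s in (0 : ℝ)..(N * h), g (y s) (u s) * Real.exp (-(lam * s)))
      (discCost f g lam h N v y₀)
    rw [add_mul, add_mul]
    linarith
  constructor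
  · intro u hu y hy N
    have hgrow := fun t ht => hy.norm_sub_initial_le hf hu.2 hF0 hfy hL hLμ (T := t) ht
    have hF := fun t ht => norm_le_of_growth hf hL hF0 hfy hμ.le ht (hgrow t ht)
    have hG := fun t ht => norm_le_of_growth hg hLg hG0 hgy hμ.le ht (hgrow t ht)
    obtain ⟨v, hv, hdef⟩ := IsTrajectory.exists_stepDefect_le hfc hgc
      hu.1.aestronglyMeasurable hu.2 hF₁0 hG₁0 hμ.le hh hF hG N
    exact ⟨v, hv, key u hu y hy N v hv hdef⟩
  · intro v hv N
    have hu := stepControl_mem_admissibleControls (h := h) hUb hv h0 N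
    obtain ⟨y, hy⟩ := exists_isTrajectory hfc hf hL hu.1.aestronglyMeasurable hu.2 hF0 hfy
    refine ⟨_, hu, y, hy, key _ hu y hy N v hv fun k hk => ?_⟩
    have hz : ∀ {F' : Type} [NormedAddCommGroup F'] [NormedSpace ℝ F'] [CompleteSpace F']
        (Φ : E n → E m → F'),
        ∑ j ∈ Finset.range k, stepDefect Φ y (stepControl v h N) v h j = 0 := fun Φ =>
      Finset.sum_eq_zero fun j hj => stepDefect_stepControl Φ y v hh
        (by have := Finset.mem_range.1 hj; omega)
    rw [hz f, hz g, norm_zero, norm_zero, and_self]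
    positivity

end Controls

/-! ### Uniform bounds and assembly of the error estimate -/

lemma exists_bound_norm_le_of_isCompact {n m : ℕ} {F' : Type*} [NormedAddCommGroup F']
    {Φ : E n → E m → F'} (hΦ : Continuous fun p : E n × E m => Φ p.1 p.2) {K : Set (E n)}
    {U : Set (E m)} (hK : IsCompact K) (hU : IsCompact U) :
    ∃ C : ℝ, 0 ≤ C ∧ ∀ x ∈ K, ∀ u ∈ U, ‖Φ x u‖ ≤ C := by
  obtain ⟨C, hC⟩ := (hK.prod hU).exists_bound_of_continuousOn hΦ.continuousOn
  exact ⟨max C 0, le_max_right _ _, fun x hx u hu =>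
    (hC (x, u) ⟨hx, hu⟩).trans (le_max_left _ _)⟩

/-- The value function is compared with a number by comparing discrete costs. -/
lemma abs_valueFunction_sub_le {n m : ℕ} {f : E n → E m → E n} {g : E n → E m → ℝ}
    {lam : ℝ} {U : Set (E m)} {y₀ : E n} {a ε : ℝ}
    (h1 : ∀ u ∈ admissibleControls U, ∀ y, IsTrajectory f u y₀ y → a ≤ cost g lam y u + ε)
    (h2 : ∀ ε' > ε, ∃ u ∈ admissibleControls U, ∃ y, IsTrajectory f u y₀ y ∧
      cost g lam y u ≤ a + ε') :
    |valueFunction f g lam U y₀ - a| ≤ ε := by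
  have hbdd : a - ε ∈ lowerBounds {c | ∃ u ∈ admissibleControls U, ∃ y, IsTrajectory f u y₀ y ∧
      c = cost g lam y u} := by
    rintro _ ⟨u, hu, y, hy, rfl⟩
    linarith [h1 u hu y hy]
  rw [abs_le]
  constructor
  · obtain ⟨u, hu, y, hy, -⟩ := h2 (ε + 1) (by linarith)
    have : a - ε ≤ valueFunction f g lam U y₀ := le_csInf ⟨_, u, hu, y, hy, rfl⟩ hbdd
    linarith
  · refine le_of_forall_pos_le_add fun δ hδ => ?_
    obtain ⟨u, hu, y, hy, hle⟩ := h2 (ε + δ) (by linarith)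
    have : valueFunction f g lam U y₀ ≤ cost g lam y u := csInf_le ⟨_, hbdd⟩ ⟨u, hu, y, hy, rfl⟩
    linarith

end PODHJB

end

open PODHJB in
/-- The error bound is proved by comparing, on finite horizons, the cost of continuous controls and
the solution of the scheme with the costs of discrete control sequences in the full space. The rate
`O(h)` comes from the Bárány–Grinberg theorem on prefix sums, which replaces arguments based on the
semiconcavity of the value function, and exponential weights replace the invariance of `Ω`. -/
theorem theorem4p8 {n m : ℕ}
    (f : PODHJB.E n → PODHJB.E m → PODHJB.E n) (g : PODHJB.E n → PODHJB.E m → ℝ)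
    (U : Set (PODHJB.E m)) (hUcomp : IsCompact U) (hUconv : Convex ℝ U)
    (hUad : (PODHJB.admissibleControls U).Nonempty)
    (Mm : Matrix (Fin n) (Fin n) ℝ) (hMm : Mm.PosDef)
    (Ω : Set (PODHJB.E n)) (hΩ : PODHJB.IsBoundedPolyhedron Ω)
    (lam Lf Lg : ℝ)
    (hass : PODHJB.StandingAssumption f g U Ω Lf Lg)
    (hsemi : PODHJB.Semiconcave f g U)
    (hinv : ∀ᶠ h in 𝓝[>] (0 : ℝ), ∀ y ∈ closure Ω, ∀ u ∈ U, y + h • f y u ∈ closure Ω)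
    (hlam : max Lf Lg < lam)
    (R : ℝ) :
    ∃ c₀ c₁ c₂ : ℝ, 0 ≤ c₀ ∧ 0 ≤ c₁ ∧ 0 ≤ c₂ ∧
      ∀ (l : ℕ) (Ψ : Matrix (Fin n) (Fin l) ℝ), Ψ.transpose * Mm * Ψ = 1 →
      ∀ Ωl : Set (PODHJB.E l), PODHJB.IsBoundedPolyhedron Ωl → (∀ z ∈ Ωl, ‖z‖ ≤ R) →
      (∀ y ∈ closure Ω, PODHJB.mulE (Ψ.transpose * Mm) y ∈ interior Ωl) →
      ∀ 𝒯 : Geometry.SimplicialComplex ℝ (PODHJB.E l), PODHJB.IsTriangulation 𝒯 Ωl →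
      ∀ h : ℝ, 0 < h → h < 1 / lam →
      (∀ y ∈ closure Ω, ∀ u ∈ U,
        PODHJB.mulE (Ψ.transpose * Mm) (y + h • f (PODHJB.proj Mm Ψ y) u) ∈ closure Ωl) →
      ∀ w : PODHJB.E l → ℝ, PODHJB.IsSchemeSolution f g lam U Mm Ψ Ωl 𝒯 h w →
      ∀ y ∈ closure Ω,
        |PODHJB.valueFunction f g lam U y - PODHJB.lift Mm Ψ w y| ≤
          c₀ * h + c₁ * PODHJB.specNorm Ψ * PODHJB.meshSize 𝒯 / h
            + c₂ * PODHJB.projError Mm Ψ Ω / h := by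
  have hL := hass.Lf_pos
  have hLg := hass.Lg_pos.le
  have hLlam : Lf < lam := (le_max_left _ _).trans_lt hlam
  have hlam0 : 0 < lam := hL.trans hLlam
  have hd : 0 < lam - Lf := by linarith
  have h0U := zero_mem_of_admissibleControls_nonempty hUcomp.isClosed hUad
  have hΩcomp : IsCompact (closure Ω) := by
    obtain ⟨-, 𝒯, hT⟩ := hΩ
    exact hT.isCompact_closure
  obtain ⟨c, r, hr, hball⟩ := hΩ.exists_ball_subset
  obtain ⟨F, hF0, hF⟩ := exists_bound_norm_le_of_isCompact hass.f_cont hΩcomp hUcomp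
  obtain ⟨G, hG0, hG⟩ := exists_bound_norm_le_of_isCompact hass.g_cont hΩcomp hUcomp
  obtain ⟨cM, hcM0, hcM⟩ := exists_norm_mulE_le_of_orthonormal Mm hMm
  -- The ball contains all lifted points `Ψ z` with `z ∈ closure Ωl`, whatever the rank and the
  -- basis, so `F'` depends only on the data and `R`.
  obtain ⟨F', hF'0, hF'⟩ := exists_bound_norm_le_of_isCompact hass.f_cont
    (isCompact_closedBall (0 : E n) (cM * |R|)) hUcomp
  obtain ⟨C, κ, hC0, hκ, hC⟩ := exists_cost_error_bound hass.f_cont hass.g_cont hass.f_lip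
    hass.g_lip hL.le hLg hLlam hUcomp.isBounded h0U hF0 hG0
  set K := Lg / (lam - Lf) with hK
  have hK0 : 0 ≤ K := by positivity
  -- `K / lam` is the mesh error summed by the geometric series. The last constant collects the
  -- change of initial state, `K * pE`, and the projected dynamics, `K * (2 / r * F') / lam * pE`;
  -- the outer division by `lam` comes from weakening `pE` to `pE / (lam * h)`.
  refine ⟨C, K / lam, (K + K * (2 / r * F') / lam) / lam, hC0, by positivity, by positivity, ?_⟩
  intro l Ψ hΨ Ωl hΩl hR hint 𝒯 hT h hh hh' _ w hw y hy
  have hh1 : lam * h < 1 := by rwa [lt_div_iff₀ hlam0, mul_comm] at hh'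
  set pE := projError Mm Ψ Ω with hpE
  have hpE0 : 0 ≤ pE := projError_nonneg
  set z := mulE (Ψ.transpose * Mm) y with hz
  have hzmem : z ∈ closure Ωl := subset_closure (interior_subset (hint y hy))
  -- `B` depends on `w`, but it only occurs multiplied by `(1 - lam * h) ^ N` and disappears in the
  -- limit.
  obtain ⟨B, hB⟩ := hT.isCompact_closure.exists_bound_of_continuousOn hw.affine.1
  have hRc : ∀ x ∈ closure Ωl, ‖x‖ ≤ R := fun x hx => by
    have : closure Ωl ⊆ Metric.closedBall 0 R :=
      closure_minimal (fun x hx => by simpa using hR x hx) Metric.isClosed_closedBall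
    simpa using this hx
  have hη : ∀ x ∈ closure Ωl, ∀ u ∈ U,
      ‖f (mulE Ψ x) u - proj Mm Ψ (f (mulE Ψ x) u)‖ ≤ 2 / r * pE * F' := by
    intro x hx u hu
    refine (norm_sub_proj_le hΩcomp hr hball _).trans ?_
    gcongr
    refine hF' _ ?_ u hu
    rw [mem_closedBall_zero_iff]
    refine (hcM l Ψ hΨ x).trans ?_
    gcongr
    exact (hRc x hx).trans (le_abs_self R)
  set δ := K * (specNorm Ψ * meshSize 𝒯) + K * (h * (2 / r * pE * F')) with hδ
  have hcmp := fun N => hw.compare_discCost hass.f_lip hass.g_lip hL hLg hLlam hh hh1 hT hB hη hδ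
    ⟨0, h0U⟩ N z hzmem
  obtain ⟨hup, hlow⟩ := hC h hh hh1.le y (hF y hy) (hG y hy)
  have hlip : ∀ N (u : ℕ → E m), (∀ k, u k ∈ U) →
      |discCost f g lam h N u y - discCost f g lam h N u (mulE Ψ z)| ≤ K * pE := by
    intro N u hu
    refine (abs_discCost_sub_le hass.f_lip hass.g_lip hL.le hLg hLlam hh hh1 N u hu _ _).trans ?_
    rw [hz, ← proj_eq]
    exact mul_le_mul_of_nonneg_left (norm_sub_proj_le_projError hΩcomp hy) hK0
  -- The horizon `N` is auxiliary and independent of `h`: all terms containing it vanish for fixed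
  -- `h`.
  have hrem : Tendsto (fun N : ℕ => (C * h + K * pE + δ / (lam * h))
      + ((1 - lam * h) ^ N * B + C * Real.exp (-(κ * (N * h))))) atTop
      (𝓝 (C * h + K * pE + δ / (lam * h))) := by
    have h1 : Tendsto (fun N : ℕ => (1 - lam * h) ^ N * B) atTop (𝓝 (0 * B)) :=
      (tendsto_pow_atTop_nhds_zero_of_lt_one (by linarith) (by nlinarith)).mul_const B
    have h2 : Tendsto (fun N : ℕ => C * Real.exp (-(κ * (N * h)))) atTop (𝓝 (C * 0)) := by
      refine (Real.tendsto_exp_atBot.comp (tendsto_neg_atTop_atBot.comp ?_)).const_mul C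
      exact (tendsto_natCast_atTop_atTop.atTop_mul_const hh).const_mul_atTop hκ
    simpa using (h1.add h2).const_add (C * h + K * pE + δ / (lam * h))
  have hmain : |valueFunction f g lam U y - lift Mm Ψ w y|
      ≤ C * h + K * pE + δ / (lam * h) := by
    refine abs_valueFunction_sub_le (fun u hu x hx => ?_) fun ε' hε' => ?_
    · have : ∀ N : ℕ, w z - cost g lam x u ≤ (C * h + K * pE + δ / (lam * h))
          + ((1 - lam * h) ^ N * B + C * Real.exp (-(κ * (N * h)))) := by
        intro N
        obtain ⟨v, hv, hle⟩ := hup u hu x hx N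
        have h1 := (hcmp N).1 v hv
        have h2 := (abs_le.1 (hlip N v hv)).1
        have h3 := (abs_le.1 hle).1
        linarith
      have := ge_of_tendsto' hrem this
      rw [lift, ← hz]
      linarith
    · obtain ⟨N, hN⟩ := (hrem.eventually_lt_const hε').exists
      obtain ⟨v, hv, hle⟩ := (hcmp N).2
      obtain ⟨u, hu, x, hx, hcost⟩ := hlow v hv N
      refine ⟨u, hu, x, hx, ?_⟩
      have h2 := (abs_le.1 (hlip N v hv)).2
      have h3 := (abs_le.1 hcost).2
      rw [lift, ← hz]
      linarith
  refine hmain.trans ?_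
  have h1 : K * pE ≤ K * pE / (lam * h) := by
    rw [le_div_iff₀ (by positivity)]
    exact mul_le_of_le_one_right (by positivity) hh1.le
  have h2 : K * (2 / r * F') / lam * pE ≤ K * (2 / r * F') / lam * pE / (lam * h) := by
    rw [le_div_iff₀ (by positivity)]
    exact mul_le_of_le_one_right (by positivity) hh1.le
  calc C * h + K * pE + δ / (lam * h)
      = C * h + K / lam * specNorm Ψ * meshSize 𝒯 / h
        + (K * pE + K * (2 / r * F') / lam * pE) := by
        rw [hδ]; field_simp; ring
    _ ≤ C * h + K / lam * specNorm Ψ * meshSize 𝒯 / h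
        + (K * pE / (lam * h) + K * (2 / r * F') / lam * pE / (lam * h)) := by gcongr
    _ = _ := by field_simp
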